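/- Let $\mathbb K$ be a field of characteristic $0$, $n\ge 1$, and let $V=\bigoplus_{\alpha\in\mathbb Z^n}V^\alpha$ be a $\mathbb Z^n$-graded $\mathbb K$-vector space. Write $\langle\alpha,\beta\rangle=\sum_i\alpha_i\beta_i$, $e_1=(1,0,\dots,0)$, and let the symbol of a homogeneous vector or map also denote its degree. Tensor products of maps follow the rule $(f\otimes g)(x\otimes y)=(-1)^{\langle g,x\rangle}f(x)\otimes g(y)$. *Loday structures.* For $A\in\mathbb Z^n$ and an integer $a\ge0$, let $M^{(A,a)}(V)$ be the space of $(a+1)$-linear maps $V^{a+1}\to V$ of weight $A$, and let $M_r(V)=\bigoplus_{(A,a)}M^{(A,a)}(V)$, which is $\mathbb Z^{n+1}$-graded (the components with $a<0$ being $0$). Let $\mathrm{Lod}(V)\subset M^{(0,1)}(V)$ be the set of graded Loday structures on $V$, i.e. of weight $0$ bilinear brackets with $\{a,\{b,c\}\}=\{\{a,b\},c\}+(-1)^{\langle a,b\rangle}\{b,\{a,c\}\}$ for all homogeneous $a,b,c\in V$. *The coalgebra.* For a $\mathbb Z^n$-graded space $W$ let $T(W)=\bigoplus_{p\ge1}W^{\otimes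 p}$, with its $\mathbb Z^n$-grading and the coproduct $$\Delta(w_1\otimes\dots\otimes w_p)=\sum_{I\sqcup J=\{1,\dots,p-1\},\ I\ne\emptyset}\varepsilon_W(I;J)\;W_I\bigotimes (W_J\otimes w_p),$$ where $W_I$ is the tensor product of the $w_i$, $i\in I$, in increasing order, and $\varepsilon_W(I;J)$ is the Koszul sign of $(w_I,w_J)\mapsto w_{I\cup J}$. A coderivation of weight $Q$ is a linear map $Q$ of weight $Q$ with $\Delta Q=(Q\otimes\mathrm{id}+\mathrm{id}\otimes Q)\Delta$; its corestriction maps are $Q_p:W^{\otimes p}\hookrightarrow T(W)\xrightarrow{Q}T(W)\to W$, $p\ge1$; it is a codifferential if $Q^2=0$. Let $\mathrm{CoDiff}^{Q}_{p}(T(W))$ be the set of codifferentials of weight $Q$ all of whose corestriction maps vanish, except possibly $Q_p$. *The maps $\phi$.* Let $\downarrow V$ be the space $V$ with the grading $(\downarrow V)^\alpha=V^{\alpha+e_1}$, let $\downarrow:V\to\downarrow V$ be the identity, of weight $-e_1$, and let $\uparrow$ be its inverse, of weight $e_1$. For $A\in M^{(A,a)}(V)$ let $\phi_{(A,a)}(A)=Q^A$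 be the map on $T(\downarrow V)$ of weight $A+ae_1$ obtained from $q=(-1)^{a(a+1)/2}\downarrow\circ A\circ\uparrow^{\otimes(a+1)}$ by $$Q^A(w_1\otimes\dots\otimes w_p)=\sum\varepsilon_{\downarrow V}(I;J)(-1)^{\langle A+ae_1,W_I\rangle}\,W_I\otimes q(W_J\otimes w_{k_1})\otimes W_{K\setminus k_1},$$ where the sum is over all $I\sqcup J\sqcup K=\{1,\dots,p\}$ with $K\neq\emptyset$, $|J|=a$, and all elements of $I$ and $J$ smaller than $k_1=\min K$. It is a coderivation, and $A=\uparrow\circ Q^A_{a+1}\circ\downarrow^{\otimes(a+1)}$. *The stem bracket.* For $A\in M^{(A,a)}(V)$ and $B\in M^{(B,b)}(V)$ put $$[A,B]^{\otimes}=(-1)^{1+\langle ae_1,\,be_1+B\rangle}\,\phi_{(A+B,a+b)}^{-1}\big([\phi_{(A,a)}(A),\phi_{(B,b)}(B)]\big),$$ where $[P,Q]=PQ-(-1)^{\langle P,Q\rangle}QP$ and $\phi_{(C,c)}^{-1}(Q)=\uparrow\circ Q_{c+1}\circ\downarrow^{\otimes(c+1)}$; extend it bilinearly to $M_r(V)$.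 **Theorem.** 1. The restriction of $\phi_{(0,1)}$ to $\mathrm{Lod}(V)$ is a bijection $\mathrm{Lod}(V)\to\mathrm{CoDiff}_2^{e_1}(T(\downarrow V))$. 2. $(M_r(V),[-,-]^\otimes)$ is a $\mathbb Z^{n+1}$-graded Lie algebra (the bracket has weight $0$, is graded skew-symmetric, and satisfies the graded Jacobi identity, with the signs $(-1)^{\langle A,B\rangle+ab}$), and the graded Loday structures on $V$ are exactly its canonical elements of weight $(0,1)$, i.e. the elements $\pi$ of degree $(0,1)$ such that $(0,1)$ is odd ($\langle(0,1),(0,1)\rangle$ is an odd number) and $[\pi,\pi]^\otimes=0$. -/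

import Mathlib

open scoped DirectSum TensorProduct

noncomputable section

namespace StemBracket

/-- Degrees in `ℤⁿ`. -/
abbrev Deg (n : ℕ) : Type := Fin n → ℤ

/-- The sign `(-1)^⟨a, b⟩`, where `⟨a, b⟩ = ∑ i, a i * b i`. -/
def sgn {n : ℕ} (a b : Deg n) : ℤˣ := Int.negOnePow (dotProduct a b)

/-- A degree is odd if `⟨a, a⟩` is an odd integer. -/
def IsOddDeg {n : ℕ} (a : Deg n) : Prop := Odd (dotProduct a a)

/-- `e₁ = (1, 0, …, 0)`. -/
def e₁ {n : ℕ} [NeZero n] : Deg n := Pi.single 0 1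

/-! ### Graded Lie algebras and canonical elements -/

/-- A bilinear bracket of weight `0` on the `ℤᵐ`-graded space `(L, ℒ)` is a graded Lie bracket:
it is graded skew-symmetric and satisfies the graded Jacobi identity. -/
structure IsGradedLieAlgebra {K L : Type*} [Field K] [AddCommGroup L] [Module K L] {m : ℕ}
    (ℒ : Deg m → Submodule K L) (br : L →ₗ[K] L →ₗ[K] L) : Prop where
  isInternal : DirectSum.IsInternal ℒ
  weight_zero : ∀ (a b : Deg m) (x y : L), x ∈ ℒ a → y ∈ ℒ b → br x y ∈ ℒ (a + b)
  skew : ∀ (a b : Deg m) (x y : L), x ∈ ℒ a → y ∈ ℒ b → br x y = -(sgn a b • br y x)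
  jacobi : ∀ (a b c : Deg m) (x y z : L), x ∈ ℒ a → y ∈ ℒ b → z ∈ ℒ c →
    br x (br y z) = br (br x y) z + sgn a b • br y (br x z)

/-- `x` is a canonical element of weight `d` for the bracket `br`: it is homogeneous of degree `d`,
odd, and squares to zero. -/
def IsCanonical {K L : Type*} [Field K] [AddCommGroup L] [Module K L] {m : ℕ}
    (ℒ : Deg m → Submodule K L) (br : L →ₗ[K] L →ₗ[K] L) (d : Deg m) (x : L) : Prop :=
  x ∈ ℒ d ∧ IsOddDeg d ∧ br x x = 0

/-! ### Multilinear maps and signs on homogeneous arguments -/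

section Graded

variable {K V W : Type*} [Field K] [AddCommGroup V] [Module K V] [AddCommGroup W] [Module K W]
variable {n : ℕ} (𝒱 : Deg n → Submodule K V)

/-- `M^{(A,a)}(V)`, for `x = (A, a)` with `a ≥ 0`: the `(a+1)`-linear maps of weight `A`. -/
def Mult (x : Deg n × ℕ) : Submodule K (MultilinearMap K (fun _ : Fin (x.2 + 1) => V) V) where
  carrier := {f | ∀ (d : Fin (x.2 + 1) → Deg n) (v : Fin (x.2 + 1) → V),
    (∀ i, v i ∈ 𝒱 (d i)) → f v ∈ 𝒱 (x.1 + ∑ i, d i)}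
  add_mem' hf hg d v hv := add_mem (hf d v hv) (hg d v hv)
  zero_mem' _ _ _ := zero_mem _
  smul_mem' c _ hf d v hv := Submodule.smul_mem _ c (hf d v hv)

/-- The desuspension `↓V`: the same space `V` with the grading `(↓V)^α = V^{α + e₁}`. The maps
`↓ : V → ↓V` and `↑ : ↓V → V` are the identity on the underlying space. -/
def desusp [NeZero n] : Deg n → Submodule K V := fun α => 𝒱 (α + e₁)

instance desuspDecomposition [NeZero n] [DirectSum.Decomposition 𝒱] :
    DirectSum.Decomposition (desusp 𝒱) :=
  DirectSum.IsInternal.chooseDecomposition _ (by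
    have h := (DirectSum.isInternal_submodule_iff_iSupIndep_and_iSup_eq_top _).1
      (DirectSum.Decomposition.isInternal 𝒱)
    refine (DirectSum.isInternal_submodule_iff_iSupIndep_and_iSup_eq_top _).2 ⟨?_, ?_⟩
    · exact h.1.comp (add_left_injective (e₁ : Deg n))
    · exact ((Equiv.addRight (e₁ : Deg n)).iSup_comp (g := 𝒱)).trans h.2)

variable [DirectSum.Decomposition 𝒱]

/-- The multilinear map whose value on homogeneous `v₁, …, v_p` of degrees `d₁, …, d_p` is
`s(d₁, …, d_p) f(v₁, …, v_p)`; see `signed_apply`. -/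
def signed {p : ℕ} (s : (Fin p → Deg n) → ℤˣ) (f : MultilinearMap K (fun _ : Fin p => V) W) :
    MultilinearMap K (fun _ : Fin p => V) W :=
  (MultilinearMap.fromDirectSumEquiv (R := K) (κ := fun _ : Fin p => Deg n)
    (M := fun (_ : Fin p) (d : Deg n) => 𝒱 d)
    (fun d => s d • f.compLinearMap (fun i => (𝒱 (d i)).subtype))).compLinearMap
      (fun _ => (DirectSum.decomposeLinearEquiv 𝒱).toLinearMap)

theorem signed_apply {p : ℕ} (s : (Fin p → Deg n) → ℤˣ)
    (f : MultilinearMap K (fun _ : Fin p => V) W) (d : Fin p → Deg n) (v : Fin p → V)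
    (hv : ∀ i, v i ∈ 𝒱 (d i)) : signed 𝒱 s f v = s d • f v := by
  have h : (fun i => (DirectSum.decomposeLinearEquiv 𝒱).toLinearMap (v i)) =
      fun i => DirectSum.lof K _ (fun d => 𝒱 d) (d i) ⟨v i, hv i⟩ := by
    funext i
    exact DirectSum.decompose_of_mem 𝒱 (hv i)
  rw [signed, MultilinearMap.compLinearMap_apply, h]
  erw [MultilinearMap.fromDirectSumEquiv_lof]
  rfl

/-- Multilinear maps that agree on homogeneous arguments are equal. -/
theorem ext_homogeneous {p : ℕ} {f g : MultilinearMap K (fun _ : Fin p => V) W}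
    (h : ∀ (d : Fin p → Deg n) (v : Fin p → V), (∀ i, v i ∈ 𝒱 (d i)) → f v = g v) : f = g := by
  have key : f.compLinearMap (fun _ => (DirectSum.decomposeLinearEquiv 𝒱).symm.toLinearMap) =
      g.compLinearMap (fun _ => (DirectSum.decomposeLinearEquiv 𝒱).symm.toLinearMap) := by
    refine MultilinearMap.directSum_ext (M := fun (_ : Fin p) (d : Deg n) => 𝒱 d) fun d => ?_
    ext w
    simp only [MultilinearMap.compLinearMap_apply]
    refine h d _ fun i => ?_
    have h2 : (DirectSum.decomposeLinearEquiv 𝒱).symm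
        (DirectSum.lof K _ (fun d => 𝒱 d) (d i) (w i)) = (w i : V) :=
      DirectSum.decompose_symm_of 𝒱 (w i)
    exact h2.symm ▸ (w i).2
  ext v
  have := congrArg (fun F => F fun i => DirectSum.decomposeLinearEquiv 𝒱 (v i)) key
  simpa only [MultilinearMap.compLinearMap_apply, LinearEquiv.coe_coe,
    LinearEquiv.symm_apply_apply] using this

theorem signed_add {p : ℕ} (s : (Fin p → Deg n) → ℤˣ)
    (f g : MultilinearMap K (fun _ : Fin p => V) W) :
    signed 𝒱 s (f + g) = signed 𝒱 s f + signed 𝒱 s g :=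
  ext_homogeneous 𝒱 fun d v hv => by
    simp only [add_apply, signed_apply 𝒱 s _ d v hv, smul_add]

theorem signed_smul {p : ℕ} (s : (Fin p → Deg n) → ℤˣ) (c : K)
    (f : MultilinearMap K (fun _ : Fin p => V) W) :
    signed 𝒱 s (c • f) = c • signed 𝒱 s f :=
  ext_homogeneous 𝒱 fun d v hv => by
    simp only [smul_apply, signed_apply 𝒱 s _ d v hv, smul_comm c]

end Graded

/-! ### The tensor coalgebra `(T(V), Δ)` -/

section Coalgebra

/-- The reduced tensor algebra `T(V) = ⨁_{p ≥ 1} V^{⊗p}`; the summand of index `p` is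
`V^{⊗(p+1)}`. -/
def T (K V : Type*) [Field K] [AddCommGroup V] [Module K V] : Type _ :=
  ⨁ p : ℕ, ⨂[K]^(p + 1) V

instance (K V : Type*) [Field K] [AddCommGroup V] [Module K V] : AddCommGroup (T K V) :=
  inferInstanceAs (AddCommGroup (⨁ p : ℕ, ⨂[K]^(p + 1) V))

instance (K V : Type*) [Field K] [AddCommGroup V] [Module K V] : Module K (T K V) :=
  inferInstanceAs (Module K (⨁ p : ℕ, ⨂[K]^(p + 1) V))

/-- The inclusion of `V^{⊗(p+1)}` in `T(V)`. -/
def T.incl (K V : Type*) [Field K] [AddCommGroup V] [Module K V] (p : ℕ) :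
    ⨂[K]^(p + 1) V →ₗ[K] T K V :=
  DirectSum.lof K ℕ (fun p => ⨂[K]^(p + 1) V) p

/-- The linear map on `T(V)` with prescribed restrictions to the summands. -/
def T.desc {K V W : Type*} [Field K] [AddCommGroup V] [Module K V] [AddCommMonoid W] [Module K W]
    (F : ∀ p : ℕ, ⨂[K]^(p + 1) V →ₗ[K] W) : T K V →ₗ[K] W :=
  DirectSum.toModule K ℕ W F

theorem T.desc_incl {K V W : Type*} [Field K] [AddCommGroup V] [Module K V] [AddCommMonoid W]
    [Module K W] (F : ∀ p : ℕ, ⨂[K]^(p + 1) V →ₗ[K] W) (p : ℕ) (x : ⨂[K]^(p + 1) V) :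
    T.desc F (T.incl K V p x) = F p x :=
  DirectSum.toModule_lof (M := fun p : ℕ => ⨂[K]^(p + 1) V) K (φ := F) p x

variable (K : Type*) {V : Type*} [Field K] [AddCommGroup V] [Module K V]

/-- The word `v₁ ⊗ … ⊗ v_p ∈ T(V)` (for `p = 0`, where there is none, the value is `0`). -/
def word : (p : ℕ) → MultilinearMap K (fun _ : Fin p => V) (T K V)
  | 0 => 0
  | p + 1 => (T.incl K V p).compMultilinearMap (PiTensorProduct.tprod K)

/-- The canonical projection `pr : T(V) → V`. -/
def pr : T K V →ₗ[K] V :=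
  T.desc fun
    | 0 => (PiTensorProduct.subsingletonEquiv (R := K) (s := fun _ : Fin 1 => V) (0 : Fin 1)).toLinearMap
    | _ + 1 => 0

variable {K}

/-- The linear map on `T(V)` with prescribed multilinear values on words of each length. -/
def ofWords {W : Type*} [AddCommMonoid W] [Module K W]
    (F : ∀ p : ℕ, MultilinearMap K (fun _ : Fin (p + 1) => V) W) : T K V →ₗ[K] W :=
  T.desc fun p => PiTensorProduct.lift (F p)

theorem ofWords_word {W : Type*} [AddCommMonoid W] [Module K W]
    (F : ∀ p : ℕ, MultilinearMap K (fun _ : Fin (p + 1) => V) W) (p : ℕ) (v : Fin (p + 1) → V) :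
    ofWords F (word K (p + 1) v) = F p v := by
  simp [ofWords, word, T.desc_incl]

theorem ext_words {W : Type*} [AddCommMonoid W] [Module K W] {f g : T K V →ₗ[K] W}
    (h : ∀ (p : ℕ) (v : Fin (p + 1) → V), f (word K (p + 1) v) = g (word K (p + 1) v)) :
    f = g := by
  refine DirectSum.linearMap_ext K fun p => PiTensorProduct.ext ?_
  ext v
  exact h p v

/-- The `p`-th corestriction map `Q_p : V^{⊗p} → T(V) → T(V) → V` of `Q`, `p ≥ 1`. -/
def corestriction (p : ℕ) (Q : Module.End K (T K V)) : MultilinearMap K (fun _ : Fin p => V) V :=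
  (pr K ∘ₗ Q).compMultilinearMap (word K p)

/-- `(v₁, …, v_p) ↦ V_I ⊗ V_J` in `T(V) ⊗ T(V)`, where `J` is the complement of `I`, and where
`V_S` is the word formed by the `v_s`, `s ∈ S`, in increasing order; see `split_apply`. -/
def split {p : ℕ} (I : Finset (Fin p)) :
    MultilinearMap K (fun _ : Fin p => V) (T K V ⊗[K] T K V) :=
  ((word K I.card).domCoprod (word K Iᶜ.card)).domDomCongr (finSumEquivOfFinset rfl rfl)

theorem split_apply {p : ℕ} (I : Finset (Fin p)) (v : Fin p → V) :
    split (K := K) I v = word K I.card (fun i => v (I.orderEmbOfFin rfl i)) ⊗ₜ[K]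
      word K Iᶜ.card (fun i => v (Iᶜ.orderEmbOfFin rfl i)) := by
  simp [split]

/-- The number of elements of `{1, …, p} \ S` that are smaller than the largest element of the
`(a+1)`-element set `S`. -/
def numBefore {p a : ℕ} (S : Finset (Fin p)) (hS : S.card = a + 1) : Fin (Sᶜ.card + 1) :=
  ⟨(Sᶜ.filter fun i => i < S.orderEmbOfFin hS (Fin.last a)).card,
    Nat.lt_succ_of_le (Finset.card_filter_le _ _)⟩

/-- For an `(a+1)`-element set `S` with largest element `k`, let `J = S \ {k}`, let `I` be the set
of the elements of `Sᶜ` smaller than `k`, and `K' = {k, …, p}`. This is the map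
`(v₁, …, v_p) ↦ V_I ⊗ q(V_J ⊗ v_k) ⊗ V_{K' \ k}`; see `insertAt_apply`. -/
def insertAt {p a : ℕ} (S : Finset (Fin p)) (hS : S.card = a + 1)
    (q : MultilinearMap K (fun _ : Fin (a + 1) => V) V) :
    MultilinearMap K (fun _ : Fin p => V) (T K V) :=
  (MultilinearMap.uncurrySum (N := fun _ : Fin (a + 1) ⊕ Fin Sᶜ.card => V)
    (((word K (Sᶜ.card + 1)).curryMid (numBefore S hS)).compMultilinearMap q)).domDomCongr
      (finSumEquivOfFinset hS rfl)

theorem insertAt_apply {p a : ℕ} (S : Finset (Fin p)) (hS : S.card = a + 1)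
    (q : MultilinearMap K (fun _ : Fin (a + 1) => V) V) (v : Fin p → V) :
    insertAt S hS q v = word K (Sᶜ.card + 1) ((numBefore S hS).insertNth (α := fun _ => V)
      (q fun i => v (S.orderEmbOfFin hS i)) fun i => v (Sᶜ.orderEmbOfFin rfl i)) := by
  simp [insertAt]

variable {n : ℕ} (𝒱 : Deg n → Submodule K V)

/-- The component `T(V)^α` of the `ℤⁿ`-grading of `T(V)`. -/
def tensorGrading (α : Deg n) : Submodule K (T K V) :=
  Submodule.span K {x | ∃ (p : ℕ) (d : Fin (p + 1) → Deg n) (v : Fin (p + 1) → V),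
    (∀ i, v i ∈ 𝒱 (d i)) ∧ ∑ i, d i = α ∧ x = word K (p + 1) v}

/-- `Q` is homogeneous of weight `D`. -/
def HasWeight (D : Deg n) (Q : Module.End K (T K V)) : Prop :=
  ∀ α, ∀ x ∈ tensorGrading 𝒱 α, Q x ∈ tensorGrading 𝒱 (α + D)

/-- The Koszul sign `ε(I; J)` of the reordering `(v_I, v_J) ↦ v_{I ∪ J}` of vectors with degrees
`d₁, …, d_p`: each `i ∈ I` is moved past all `j ∈ J` with `j < i`. -/
def koszul {p : ℕ} (d : Fin p → Deg n) (I J : Finset (Fin p)) : ℤˣ :=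
  ∏ i ∈ I, ∏ j ∈ J with j < i, sgn (d i) (d j)

/-- The sign `ε(I; J) (-1)^⟨D, V_I⟩`, where `J` is `S` without its largest element `k` and `I` is
the set of the elements smaller than `k` that are not in `S`. -/
def insertSign {p a : ℕ} (D : Deg n) (S : Finset (Fin p)) (hS : S.card = a + 1)
    (d : Fin p → Deg n) : ℤˣ :=
  let k := S.orderEmbOfFin hS (Fin.last a)
  let I := Sᶜ.filter fun i => i < k
  koszul d I (S.erase k) * sgn D (∑ i ∈ I, d i)

theorem word_mem {p : ℕ} (d : Fin (p + 1) → Deg n) (v : Fin (p + 1) → V)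
    (hv : ∀ i, v i ∈ 𝒱 (d i)) : word K (p + 1) v ∈ tensorGrading 𝒱 (∑ i, d i) :=
  Submodule.subset_span ⟨p, d, v, hv, rfl, rfl⟩

theorem pr_mem {α : Deg n} {x : T K V} (hx : x ∈ tensorGrading 𝒱 α) : pr K x ∈ 𝒱 α := by
  have h : tensorGrading 𝒱 α ≤ (𝒱 α).comap (pr K) := by
    refine Submodule.span_le.2 ?_
    rintro _ ⟨p, d, v, hv, rfl, rfl⟩
    cases p with
    | zero => simpa [pr, word, T.desc_incl] using hv 0
    | succ p => simp [pr, word, T.desc_incl]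
  exact h hx

theorem units_smul_mem {W : Type*} [AddCommGroup W] [Module K W] (P : Submodule K W) (u : ℤˣ)
    {x : W} (hx : x ∈ P) : u • x ∈ P := by
  rcases Int.units_eq_one_or u with rfl | rfl
  · simpa using hx
  · simpa [Units.smul_def] using hx

theorem insertAt_mem {p a : ℕ} {D : Deg n} {q : MultilinearMap K (fun _ : Fin (a + 1) => V) V}
    (hq : q ∈ Mult 𝒱 (D, a)) (S : Finset (Fin p)) (hS : S.card = a + 1)
    (d : Fin p → Deg n) (v : Fin p → V) (hv : ∀ i, v i ∈ 𝒱 (d i)) :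
    insertAt S hS q v ∈ tensorGrading 𝒱 (∑ i, d i + D) := by
  have hsum : ∑ i, ((numBefore S hS).insertNth (α := fun _ => Deg n)
      (D + ∑ i, d (S.orderEmbOfFin hS i)) fun i => d (Sᶜ.orderEmbOfFin rfl i)) i =
        ∑ i, d i + D := by
    rw [Fin.sum_univ_succAbove _ (numBefore S hS),
      ← (finSumEquivOfFinset hS rfl).sum_comp d, Fintype.sum_sum_type]
    simp only [Fin.insertNth_apply_same, Fin.insertNth_apply_succAbove,
      finSumEquivOfFinset_inl, finSumEquivOfFinset_inr]
    abel
  rw [insertAt_apply, ← hsum]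
  refine word_mem 𝒱 _ _ fun i => ?_
  cases i using Fin.succAboveCases (numBefore S hS) with
  | x => simpa only [Fin.insertNth_apply_same] using hq _ _ fun i => hv _
  | p i => simpa only [Fin.insertNth_apply_succAbove] using hv _

theorem HasWeight.comp {D E : Deg n} {P Q : Module.End K (T K V)} (hP : HasWeight 𝒱 D P)
    (hQ : HasWeight 𝒱 E Q) : HasWeight 𝒱 (D + E) (P ∘ₗ Q) := fun α x hx => by
  have := hP _ _ (hQ _ _ hx)
  rwa [add_assoc, add_comm E D] at this

/-- The graded commutator `[P, Q] = PQ - (-1)^⟨D, E⟩ QP` of maps of weights `D` and `E`. -/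
def commutator (D E : Deg n) :
    Module.End K (T K V) →ₗ[K] Module.End K (T K V) →ₗ[K] Module.End K (T K V) :=
  LinearMap.mk₂ K (fun P Q => P ∘ₗ Q - sgn D E • (Q ∘ₗ P))
    (fun P P' Q => by simp only [LinearMap.add_comp, LinearMap.comp_add, smul_add]; abel)
    (fun c P Q => by
      simp only [LinearMap.smul_comp, LinearMap.comp_smul, smul_sub, smul_comm c])
    (fun P Q Q' => by simp only [LinearMap.add_comp, LinearMap.comp_add, smul_add]; abel)
    (fun c P Q => by
      simp only [LinearMap.smul_comp, LinearMap.comp_smul, smul_sub, smul_comm c])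

theorem commutator_apply (D E : Deg n) (P Q : Module.End K (T K V)) :
    commutator D E P Q = P ∘ₗ Q - sgn D E • (Q ∘ₗ P) :=
  rfl

theorem commutator_hasWeight {D E : Deg n} {P Q : Module.End K (T K V)}
    (hP : HasWeight 𝒱 D P) (hQ : HasWeight 𝒱 E Q) :
    HasWeight 𝒱 (D + E) (commutator D E P Q) := fun α x hx => by
  refine sub_mem (hP.comp 𝒱 hQ α x hx) (units_smul_mem (x := Q (P x)) _ _ ?_)
  rw [add_comm D E]
  exact hQ.comp 𝒱 hP α x hx

variable [DirectSum.Decomposition 𝒱]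

/-- The coproduct `Δ(v₁ ⊗ … ⊗ v_p) = ∑ ε(I; J) V_I ⊗ (V_J ⊗ v_p)`, where the sum is over all
`I ∪ J = {1, …, p-1}` with `I` nonempty. The word `V_J ⊗ v_p` is that of the complement of `I` in
`{1, …, p}`, and adding the last index `p` to `J` does not change the sign. -/
def coproduct : T K V →ₗ[K] T K V ⊗[K] T K V :=
  ofWords fun p => ∑ I : {I : Finset (Fin (p + 1)) // I.Nonempty ∧ Fin.last p ∉ I},
    signed (W := T K V ⊗[K] T K V) 𝒱 (fun d => koszul d I.1 I.1ᶜ) (split I.1)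

/-- The map `x ↦ (-1)^⟨D, x⟩ x` on homogeneous `x ∈ T(V)`. -/
def parity (D : Deg n) : Module.End K (T K V) :=
  ofWords fun p => signed 𝒱 (fun d => sgn D (∑ i, d i)) (word K (p + 1))

/-- The tensor product `f ⊗ g` of linear maps, where `g` has weight `D`:
`(f ⊗ g)(x ⊗ y) = (-1)^⟨D, x⟩ f(x) ⊗ g(y)`. -/
def koszulMap (D : Deg n) (f g : Module.End K (T K V)) : Module.End K (T K V ⊗[K] T K V) :=
  TensorProduct.map (f ∘ₗ parity 𝒱 D) g

/-- `Q` is a coderivation of weight `D` of `(T(V), Δ)`: `ΔQ = (Q ⊗ id + id ⊗ Q)Δ`. -/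
def IsCoderivation (D : Deg n) (Q : Module.End K (T K V)) : Prop :=
  HasWeight 𝒱 D Q ∧
    coproduct 𝒱 ∘ₗ Q =
      (koszulMap 𝒱 0 Q LinearMap.id + koszulMap 𝒱 D LinearMap.id Q) ∘ₗ coproduct 𝒱

/-- The set of codifferentials of `(T(V), Δ)` of weight `D` all of whose corestriction maps vanish,
except possibly the `p`-th one. -/
def CoDiff (D : Deg n) (p : ℕ) : Set (Module.End K (T K V)) :=
  {Q | IsCoderivation 𝒱 D Q ∧ Q ∘ₗ Q = 0 ∧ ∀ r, 1 ≤ r → r ≠ p → corestriction r Q = 0}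

/-- The map on `T(V)` attached to a map `q : V^{⊗(a+1)} → V` of weight `D`,
`Q(v₁ ⊗ … ⊗ v_p) = ∑ ε(I; J) (-1)^⟨D, V_I⟩ V_I ⊗ q(V_J ⊗ v_k) ⊗ V_{K' \ k}`, where the sum is over
all `I ∪ J ∪ K' = {1, …, p}` with `I, J < K'`, `|J| = a`, and `k` is the smallest element of `K'`.
Such a triple is determined by the set `S = J ∪ {k}`. -/
def extend (D : Deg n) {a : ℕ} (q : MultilinearMap K (fun _ : Fin (a + 1) => V) V) :
    Module.End K (T K V) :=
  ofWords fun p => ∑ S : {S : Finset (Fin (p + 1)) // S.card = a + 1},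
    signed 𝒱 (insertSign D S.1 S.2) (insertAt S.1 S.2 q)

theorem extend_hasWeight {D : Deg n} {a : ℕ} {q : MultilinearMap K (fun _ : Fin (a + 1) => V) V}
    (hq : q ∈ Mult 𝒱 (D, a)) : HasWeight 𝒱 D (extend 𝒱 D q) := by
  intro α
  have h : tensorGrading 𝒱 α ≤ (tensorGrading 𝒱 (α + D)).comap (extend 𝒱 D q) := by
    refine Submodule.span_le.2 ?_
    rintro _ ⟨p, d, v, hv, rfl, rfl⟩
    simp only [Submodule.comap_coe, Set.mem_preimage, SetLike.mem_coe]
    rw [extend, ofWords_word, sum_apply]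
    refine Submodule.sum_mem _ fun S _ => ?_
    rw [signed_apply 𝒱 _ _ d v hv]
    exact units_smul_mem _ _ (insertAt_mem 𝒱 hq S.1 S.2 d v hv)
  exact h

theorem extend_add (D : Deg n) {a : ℕ} (q r : MultilinearMap K (fun _ : Fin (a + 1) => V) V) :
    extend 𝒱 D (q + r) = extend 𝒱 D q + extend 𝒱 D r := by
  refine ext_words fun p v => ?_
  have h : ∀ S : {S : Finset (Fin (p + 1)) // S.card = a + 1},
      insertAt S.1 S.2 (q + r) = insertAt S.1 S.2 q + insertAt S.1 S.2 r := fun S => by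
    ext v
    simp [insertAt]
  simp only [extend, ofWords_word, LinearMap.add_apply, h, signed_add, sum_apply,
    add_apply, Finset.sum_add_distrib]

theorem extend_smul (D : Deg n) {a : ℕ} (c : K)
    (q : MultilinearMap K (fun _ : Fin (a + 1) => V) V) :
    extend 𝒱 D (c • q) = c • extend 𝒱 D q := by
  refine ext_words fun p v => ?_
  have h : ∀ S : {S : Finset (Fin (p + 1)) // S.card = a + 1},
      insertAt S.1 S.2 (c • q) = c • insertAt S.1 S.2 q := fun S => by
    ext v
    simp [insertAt]
  simp only [extend, ofWords_word, LinearMap.smul_apply, h, signed_smul, sum_apply,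
    smul_apply, Finset.smul_sum]

theorem pr_word_one (v : Fin 1 → V) : pr K (word K 1 v) = v 0 := by
  simp [pr, word, T.desc_incl]

/-- The `(a+1)`-st corestriction of `extend D q` is `q`. -/
theorem corestriction_extend (D : Deg n) {a : ℕ}
    (q : MultilinearMap K (fun _ : Fin (a + 1) => V) V) :
    corestriction (a + 1) (extend 𝒱 D q) = q := by
  refine ext_homogeneous 𝒱 fun d v hv => ?_
  simp only [corestriction, LinearMap.compMultilinearMap_apply, LinearMap.comp_apply, extend,
    ofWords_word, sum_apply, map_sum]
  have huniv : (Finset.univ : Finset (Fin (a + 1))).card = a + 1 := by simp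
  have hS : ∀ (S : Finset (Fin (a + 1))) (_ : S.card = a + 1), S = Finset.univ := fun S h =>
    Finset.card_eq_iff_eq_univ S |>.1 (by simpa using h)
  rw [Finset.sum_eq_single ⟨Finset.univ, huniv⟩]
  · rw [signed_apply 𝒱 _ _ d v hv, insertAt_apply]
    have h1 : insertSign D Finset.univ huniv d = 1 := by
      simp [insertSign, koszul, sgn]
    rw [h1, one_smul]
    have key : ∀ (m : ℕ) (_ : m = 0) (r : Fin (m + 1)) (x : V) (f : Fin m → V),
        pr K (word K (m + 1) (r.insertNth (α := fun _ => V) x f)) = x := by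
      rintro _ rfl r x f
      obtain rfl : r = 0 := Subsingleton.elim (α := Fin 1) r 0
      erw [pr_word_one]
      simp
    rw [key _ (by simp)]
    congr 1
    funext i
    congr 1
    have h2 := Finset.orderEmbOfFin_unique huniv (f := id) (by simp) strictMono_id
    exact (congrFun h2 i).symm
  · rintro ⟨S, h⟩ - hne
    exact absurd (Subtype.ext (hS S h)) hne
  · simp

theorem signed_mem_Mult {x : Deg n × ℕ} (s : (Fin (x.2 + 1) → Deg n) → ℤˣ)
    {f : MultilinearMap K (fun _ : Fin (x.2 + 1) => V) V} (hf : f ∈ Mult 𝒱 x) :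
    signed 𝒱 s f ∈ Mult 𝒱 x := fun d v hv => by
  rw [signed_apply 𝒱 s f d v hv]
  exact units_smul_mem _ _ (hf d v hv)

end Coalgebra

/-! ### Loday structures and the stem bracket -/

section Stem

variable {K V : Type*} [Field K] [AddCommGroup V] [Module K V]
variable {n : ℕ} [NeZero n] (𝒱 : Deg n → Submodule K V)

/-- The set of graded Loday structures on `V`: the bilinear maps `{-,-}` of weight `0` such that
`{a, {b, c}} = {{a, b}, c} + (-1)^⟨a, b⟩ {b, {a, c}}` for all homogeneous `a, b, c`. -/
def Lod : Set (Mult 𝒱 ((0 : Deg n), 1)) :=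
  {π | ∀ (α β γ : Deg n) (a b c : V), a ∈ 𝒱 α → b ∈ 𝒱 β → c ∈ 𝒱 γ →
    π.1 ![a, π.1 ![b, c]] = π.1 ![π.1 ![a, b], c] + sgn α β • π.1 ![b, π.1 ![a, c]]}

/-- The sign `(-1)^{∑_{s=1}^p ⟨(p-s) e₁, d_s⟩}` of `↓^{⊗p}` and `↑^{⊗p}` on vectors of degrees
`d₁, …, d_p`. -/
def suspSign {p : ℕ} (d : Fin p → Deg n) : ℤˣ :=
  ∏ s : Fin p, sgn (((p : ℤ) - (s + 1)) • e₁) (d s)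

theorem mem_Mult_desusp (A : Deg n) (a : ℕ) (f : MultilinearMap K (fun _ : Fin (a + 1) => V) V) :
    f ∈ Mult (desusp 𝒱) (A + (a : ℤ) • e₁, a) ↔ f ∈ Mult 𝒱 (A, a) := by
  have h : ∀ d : Fin (a + 1) → Deg n, (A + (a : ℤ) • e₁ + ∑ i, d i) + e₁ =
      A + ∑ i, (d i + e₁) := fun d => by
    rw [Finset.sum_add_distrib]
    simp only [Finset.sum_const, Finset.card_univ, Fintype.card_fin]
    rw [← natCast_zsmul]
    push_cast
    rw [add_smul, one_smul]
    abel
  constructor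
  · intro hf d v hv
    have := hf (fun i => d i - e₁) v fun i => by simpa [desusp] using hv i
    simp only [desusp, h] at this
    simpa using this
  · intro hf d v hv
    have := hf (fun i => d i + e₁) v hv
    simpa only [desusp, h] using this

variable [DirectSum.Decomposition 𝒱]

/-- `φ_{(A,a)}`, for `x = (A, a)`: it sends `f ∈ M^{(A,a)}(V)` to the map on `T(↓V)` of weight
`A + a e₁` that extends `(-1)^{a(a+1)/2} ↓ ∘ f ∘ ↑^{⊗(a+1)}`. -/
def phi (x : Deg n × ℕ) : Mult 𝒱 x →ₗ[K] Module.End K (T K V) where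
  toFun f := extend (desusp 𝒱) (x.1 + (x.2 : ℤ) • e₁)
    (((-1 : K) ^ (x.2 * (x.2 + 1) / 2)) • signed (desusp 𝒱) suspSign f.1)
  map_add' f g := by
    simp only [Submodule.coe_add, signed_add, smul_add, extend_add]
  map_smul' c f := by
    simp only [Submodule.coe_smul, signed_smul, extend_smul, RingHom.id_apply]
    rw [smul_comm]

/-- The inverse of `φ_{(A,a)}`, for `x = (A, a)`: it sends `Q` to `↑ ∘ Q_{a+1} ∘ ↓^{⊗(a+1)}`. -/
def phiInv (x : Deg n × ℕ) :
    Module.End K (T K V) →ₗ[K] MultilinearMap K (fun _ : Fin (x.2 + 1) => V) V where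
  toFun Q := signed 𝒱 suspSign (corestriction (x.2 + 1) Q)
  map_add' P Q := by
    rw [← signed_add]
    congr 1
    ext v
    simp [corestriction]
  map_smul' c Q := by
    rw [RingHom.id_apply, ← signed_smul]
    congr 1
    ext v
    simp [corestriction]

theorem prod_negOnePow (m : ℕ) :
    ∏ i : Fin (m + 1), Int.negOnePow ((m : ℤ) - i) = Int.negOnePow ((m * (m + 1) / 2 : ℕ)) := by
  induction m with
  | zero => simp
  | succ m ih =>
    rw [Fin.prod_univ_succ]
    have h : ∀ i : Fin (m + 1), ((m + 1 : ℕ) : ℤ) - (i.succ : ℕ) = (m : ℤ) - i := by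
      intro i
      rw [Fin.val_succ]
      push_cast
      ring
    simp only [h, ih]
    rw [← Int.negOnePow_add]
    congr 1
    have e : (m + 1) * (m + 1 + 1) / 2 = m * (m + 1) / 2 + (m + 1) := by
      rw [show (m + 1) * (m + 1 + 1) = m * (m + 1) + (m + 1) * 2 by ring,
        Nat.add_mul_div_right _ _ (by norm_num)]
    rw [e]
    push_cast
    simp
    ring

theorem phiInv_phi (x : Deg n × ℕ) (f : Mult 𝒱 x) : phiInv 𝒱 x (phi 𝒱 x f) = f.1 := by
  refine ext_homogeneous 𝒱 fun d v hv => ?_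
  simp only [phiInv, phi, LinearMap.coe_mk, AddHom.coe_mk]
  rw [signed_apply 𝒱 _ _ d v hv, corestriction_extend, smul_apply,
    signed_apply (desusp 𝒱) _ _ (fun i => d i - e₁) v (by simpa [desusp] using hv)]
  have h1 : ∀ i : Fin (x.2 + 1), sgn (((x.2 + 1 : ℕ) - (i + 1) : ℤ) • e₁) (d i) *
      sgn (((x.2 + 1 : ℕ) - (i + 1) : ℤ) • e₁) (d i - e₁) = Int.negOnePow ((x.2 : ℤ) - i) := by
    intro i
    simp only [sgn, ← Int.negOnePow_add]
    rw [Int.negOnePow_eq_iff]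
    simp [dotProduct_sub, e₁]
    ring_nf
    simp [parity_simps]
  have h2 : suspSign d * suspSign (fun i => d i - e₁) =
      Int.negOnePow ((x.2 * (x.2 + 1) / 2 : ℕ)) := by
    rw [suspSign, suspSign, ← Finset.prod_mul_distrib, Finset.prod_congr rfl (fun i _ => h1 i)]
    exact prod_negOnePow _
  rw [smul_comm ((-1 : K) ^ _), smul_smul, h2]
  rw [Int.negOnePow_def, zpow_natCast, Units.smul_def]
  push_cast
  rw [← Int.cast_smul_eq_zsmul K, smul_smul]
  push_cast
  rw [← mul_pow]
  simp

theorem phi_hasWeight (x : Deg n × ℕ) (f : Mult 𝒱 x) :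
    HasWeight (desusp 𝒱) (x.1 + (x.2 : ℤ) • e₁) (phi 𝒱 x f) :=
  extend_hasWeight _ (Submodule.smul_mem _ _
    (signed_mem_Mult (x := (x.1 + (x.2 : ℤ) • e₁, x.2)) (desusp 𝒱) _
      ((mem_Mult_desusp 𝒱 x.1 x.2 _).2 f.2)))

theorem phiInv_mem (x : Deg n × ℕ) {Q : Module.End K (T K V)}
    (hQ : HasWeight (desusp 𝒱) (x.1 + (x.2 : ℤ) • e₁) Q) : phiInv 𝒱 x Q ∈ Mult 𝒱 x := by
  refine signed_mem_Mult 𝒱 _ ((mem_Mult_desusp 𝒱 x.1 x.2 _).1 fun d v hv => ?_)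
  have := pr_mem _ (hQ _ _ (word_mem _ d v hv))
  rwa [add_comm] at this

/-- The stem bracket on homogeneous elements:
`[A, B] = (-1)^{1 + ⟨a e₁, b e₁ + B⟩} φ⁻¹_{(A+B,a+b)} [φ_{(A,a)}(A), φ_{(B,b)}(B)]`
for `A ∈ M^{(A,a)}(V)` and `B ∈ M^{(B,b)}(V)`, with `x = (A, a)` and `y = (B, b)`, first as a
multilinear map. -/
def stemMap (x y : Deg n × ℕ) :
    Mult 𝒱 x →ₗ[K] Mult 𝒱 y →ₗ[K] MultilinearMap K (fun _ : Fin ((x + y).2 + 1) => V) V :=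
  -(sgn ((x.2 : ℤ) • e₁) ((y.2 : ℤ) • e₁ + y.1) •
    ((commutator (x.1 + (x.2 : ℤ) • e₁) (y.1 + (y.2 : ℤ) • e₁)).compl₁₂
      (phi 𝒱 x) (phi 𝒱 y)).compr₂ (phiInv 𝒱 (x + y)))

theorem stemMap_apply (x y : Deg n × ℕ) (f : Mult 𝒱 x) (g : Mult 𝒱 y) :
    stemMap 𝒱 x y f g = -(sgn ((x.2 : ℤ) • e₁) ((y.2 : ℤ) • e₁ + y.1) •
      phiInv 𝒱 (x + y) (commutator (x.1 + (x.2 : ℤ) • e₁) (y.1 + (y.2 : ℤ) • e₁)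
        (phi 𝒱 x f) (phi 𝒱 y g))) :=
  rfl

theorem stemMap_mem (x y : Deg n × ℕ) (f : Mult 𝒱 x) (g : Mult 𝒱 y) :
    stemMap 𝒱 x y f g ∈ Mult 𝒱 (x + y) := by
  rw [stemMap_apply]
  refine neg_mem (units_smul_mem _ _ (phiInv_mem 𝒱 (x + y) ?_))
  have h : (x + y).1 + ((x + y).2 : ℤ) • e₁ =
      (x.1 + (x.2 : ℤ) • e₁) + (y.1 + (y.2 : ℤ) • e₁) := by
    simp only [Prod.fst_add, Prod.snd_add, Nat.cast_add, add_smul]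
    abel
  rw [h]
  exact commutator_hasWeight _ (phi_hasWeight 𝒱 x f) (phi_hasWeight 𝒱 y g)

/-- The stem bracket on homogeneous elements, as an element of `M^{(A+B,a+b)}(V)`. -/
def stemHom (x y : Deg n × ℕ) : Mult 𝒱 x →ₗ[K] Mult 𝒱 y →ₗ[K] Mult 𝒱 (x + y) :=
  LinearMap.mk₂ K (fun f g => ⟨stemMap 𝒱 x y f g, stemMap_mem 𝒱 x y f g⟩)
    (fun f f' g => Subtype.ext (by simp only [map_add, LinearMap.add_apply, Submodule.coe_add]))
    (fun c f g => Subtype.ext (by simp only [map_smul, LinearMap.smul_apply, Submodule.coe_smul]))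
    (fun f g g' => Subtype.ext (by simp only [map_add, Submodule.coe_add]))
    (fun c f g => Subtype.ext (by simp only [map_smul, Submodule.coe_smul]))

end Stem

section Space

variable {K V : Type*} [Field K] [AddCommGroup V] [Module K V] {n : ℕ}
  (𝒱 : Deg n → Submodule K V)

/-- The space `M_r(V) = ⨁_{(A,a)} M^{(A,a)}(V)`, `a ≥ 0`. -/
def Mr : Type _ := ⨁ x : Deg n × ℕ, Mult 𝒱 x

instance : AddCommGroup (Mr 𝒱) := inferInstanceAs (AddCommGroup (⨁ x : Deg n × ℕ, Mult 𝒱 x))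

instance : Module K (Mr 𝒱) := inferInstanceAs (Module K (⨁ x : Deg n × ℕ, Mult 𝒱 x))

/-- The inclusion of `M^{(A,a)}(V)` in `M_r(V)`, for `x = (A, a)`. -/
def Mr.incl (x : Deg n × ℕ) : Mult 𝒱 x →ₗ[K] Mr 𝒱 :=
  DirectSum.lof K (Deg n × ℕ) (fun x => Mult 𝒱 x) x

/-- The `ℤⁿ⁺¹`-grading of `M_r(V)`: the component of degree `(A, a)` is `M^{(A,a)}(V)` if `a ≥ 0`,
and `0` if `a < 0`. -/
def Mr.grading (D : Deg (n + 1)) : Submodule K (Mr 𝒱) :=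
  ⨆ (a : ℕ) (_ : (a : ℤ) = D (Fin.last n)), LinearMap.range (Mr.incl 𝒱 (Fin.init D, a))

/-- The linear map on `M_r(V)` with prescribed restrictions to the summands. -/
def Mr.desc {W : Type*} [AddCommMonoid W] [Module K W] (F : ∀ x : Deg n × ℕ, Mult 𝒱 x →ₗ[K] W) :
    Mr 𝒱 →ₗ[K] W :=
  DirectSum.toModule K (Deg n × ℕ) W F

theorem Mr.desc_incl {W : Type*} [AddCommMonoid W] [Module K W]
    (F : ∀ x : Deg n × ℕ, Mult 𝒱 x →ₗ[K] W) (x : Deg n × ℕ) (f : Mult 𝒱 x) :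
    Mr.desc 𝒱 F (Mr.incl 𝒱 x f) = F x f :=
  DirectSum.toModule_lof (M := fun x : Deg n × ℕ => Mult 𝒱 x) K (φ := F) x f

variable [NeZero n] [DirectSum.Decomposition 𝒱]

/-- The stem bracket on `M_r(V)`. -/
def stemBracket : Mr 𝒱 →ₗ[K] Mr 𝒱 →ₗ[K] Mr 𝒱 :=
  Mr.desc 𝒱 fun x => (Mr.desc 𝒱 fun y =>
    ((stemHom 𝒱 x y).compr₂ (Mr.incl 𝒱 (x + y))).flip).flip

theorem stemBracket_incl (x y : Deg n × ℕ) (f : Mult 𝒱 x) (g : Mult 𝒱 y) :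
    stemBracket 𝒱 (Mr.incl 𝒱 x f) (Mr.incl 𝒱 y g) = Mr.incl 𝒱 (x + y) (stemHom 𝒱 x y f g) := by
  simp [stemBracket, Mr.desc_incl]

end Space

end StemBracket

end

/-!
The idea is that the maps `φ_{(A,a)}` identify `M_r(V)` with a space of coderivations of the
coalgebra `T(↓V)` that is closed under graded commutators.

Everything rests on three facts about a graded space `W` and the coalgebra `T(W)`.

* A map `extend D q` is a coderivation (`extend_isCoderivation`). Let `cons u` be the operator
  that prepends the letter `u` to a word. The sums over subsets that define the coproduct and
  `extend D q` obey recursions on the first letter: splitting the subsets of `{0, …, p}` according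
  to whether they contain `0`, one finds that
  `Δ (cons u y) = u ⊗ y + (cons u ⊗ id + id ⊗ cons u) (Δ y)` (`coproduct_cons`), and that the graded
  commutator of `extend D q` with `cons u` is the extension of `q(u, -)` (`extend_cons_succ`), or
  `cons (q u)` when `q` has only one argument (`extend_cons_zero`). So the coderivation identity
  follows by induction on the number of arguments of `q` and on the length of words, since operators
  on the two factors of `T(W) ⊗ T(W)` commute up to sign (`onRight_comp_onLeft`).
* A coderivation is determined by its corestriction maps (`IsCoderivation.ext`): for `p ≥ 2`, the
  coproduct of a word of length `p` has the term `(w₁ ⊗ … ⊗ w_{p-1}) ⊗ w_p`, from which the word can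
  be recovered (`concat_coproduct`); so if the corestriction maps vanish, the coderivation vanishes
  by induction on the length of words.
* The graded commutator of two coderivations is a coderivation (`IsCoderivation.commutator`).

Hence a coderivation of weight `A + a e₁` whose only corestriction map is the `(a+1)`-st one is in
the image of `φ_{(A,a)}` (`phi_phiInv`), and `φ` carries the stem bracket to the graded commutator,
up to a sign (`phi_stemHom`). Graded skew-symmetry and the graded Jacobi identity of the stem
bracket are therefore those of the graded commutator, because the sign is bimultiplicative.

For a bilinear map `π` of weight `0`, the coderivation `Q = φ_{(0,1)}(π)` has the odd weight `e₁`,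
so that `[Q, Q] = 2 Q²`. Therefore `Q²` is a coderivation with only one corestriction map, the third
one, which is up to signs the difference of the two sides of the graded Loday identity
(`pr_phi_phi`). In characteristic `0` it follows that `π` is a graded Loday structure if and only if
`Q² = 0` (`mem_Lod_iff`), which gives both the bijection with codifferentials and the description of
the graded Loday structures as canonical elements.
-/

noncomputable section

namespace StemBracket

/-! ### Signs -/

theorem sgn_add_left {n : ℕ} (a b c : Deg n) : sgn (a + b) c = sgn a c * sgn b c := by
  simp [sgn, add_dotProduct, Int.negOnePow_add]

theorem sgn_add_right {n : ℕ} (a b c : Deg n) : sgn a (b + c) = sgn a b * sgn a c := by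
  simp [sgn, dotProduct_add, Int.negOnePow_add]

theorem sgn_comm {n : ℕ} (a b : Deg n) : sgn a b = sgn b a := by
  simp [sgn, dotProduct_comm]

@[simp]
theorem sgn_zero_left {n : ℕ} (a : Deg n) : sgn 0 a = 1 := by simp [sgn]

@[simp]
theorem sgn_zero_right {n : ℕ} (a : Deg n) : sgn a 0 = 1 := by simp [sgn]

@[simp]
theorem sgn_mul_self {n : ℕ} (a b : Deg n) : sgn a b * sgn a b = 1 := Int.units_mul_self _

theorem sgn_sum_right {n : ℕ} {ι : Type*} (a : Deg n) (s : Finset ι) (d : ι → Deg n) :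
    sgn a (∑ i ∈ s, d i) = ∏ i ∈ s, sgn a (d i) := by
  classical
  induction s using Finset.induction_on with
  | empty => simp
  | insert i s hi ih => rw [Finset.sum_insert hi, Finset.prod_insert hi, sgn_add_right, ih]

/-! ### Subsets of `Fin (p + 1)` -/

section Subsets

variable {p : ℕ}

/-- The shift of a subset of `Fin p` to a subset of `Fin (p + 1)` that does not contain `0`. -/
abbrev shift (S : Finset (Fin p)) : Finset (Fin (p + 1)) := S.map (Fin.succEmb p)

/-- The shift of `S` together with the element `0`. -/
abbrev shift0 (S : Finset (Fin p)) : Finset (Fin (p + 1)) := insert 0 (shift S)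

theorem zero_notMem_shift (S : Finset (Fin p)) : (0 : Fin (p + 1)) ∉ shift S := by
  simp [Fin.succ_ne_zero]

theorem card_shift0 (S : Finset (Fin p)) : (shift0 S).card = S.card + 1 := by
  rw [Finset.card_insert_of_notMem (zero_notMem_shift S), Finset.card_map]

theorem compl_shift (S : Finset (Fin p)) : (shift S)ᶜ = shift0 Sᶜ := by
  ext i
  cases i using Fin.cases <;> simp [Fin.succ_ne_zero]

theorem compl_shift0 (S : Finset (Fin p)) : (shift0 S)ᶜ = shift Sᶜ := by
  ext i
  cases i using Fin.cases <;> simp [Fin.succ_ne_zero]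

/-- A sum over the subsets of `Fin (p + 1)`, split according to whether they contain `0`. -/
theorem sum_finset_fin_succ {M : Type*} [AddCommMonoid M] (F : Finset (Fin (p + 1)) → M) :
    ∑ S, F S = ∑ S : Finset (Fin p), F (shift S) + ∑ S : Finset (Fin p), F (shift0 S) := by
  have hu : (Finset.univ : Finset (Finset (Fin (p + 1)))) =
      (insert 0 (shift (Finset.univ : Finset (Fin p)))).powerset := by
    rw [show insert 0 (shift (Finset.univ : Finset (Fin p))) = Finset.univ by
      ext i
      cases i using Fin.cases <;> simp]
    simp
  have h : ∀ G : Finset (Fin (p + 1)) → M,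
      ∑ S ∈ (shift (Finset.univ : Finset (Fin p))).powerset, G S =
        ∑ S : Finset (Fin p), G (shift S) := fun G => by
    refine (Finset.sum_nbij' shift (fun S => Finset.univ.filter fun i => i.succ ∈ S)
      (fun S _ => ?_) (fun _ _ => Finset.mem_univ _) (fun S _ => ?_) (fun S hS => ?_)
      (fun _ _ => rfl)).symm
    · simp [shift, Finset.map_subset_map]
    · ext i
      simp
    · ext i
      cases i using Fin.cases with
      | zero =>
        have := fun h0 => zero_notMem_shift _ (Finset.mem_powerset.1 hS h0)
        simp [Fin.succ_ne_zero, show 0 ∉ S from this]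
      | succ i => simp
  rw [hu, Finset.sum_powerset_insert (zero_notMem_shift _), h, h fun S => F (insert 0 S)]

theorem strictMono_succ_comp {m : ℕ} {f : Fin m → Fin p} (hf : StrictMono f) :
    StrictMono fun i => (f i).succ :=
  (Fin.strictMono_succ).comp hf

theorem strictMono_cons_zero {m : ℕ} {f : Fin m → Fin p} (hf : StrictMono f) :
    StrictMono (Fin.cons 0 fun i => (f i).succ : Fin (m + 1) → Fin (p + 1)) := by
  intro i j hij
  cases i using Fin.cases with
  | zero =>
    cases j using Fin.cases with
    | zero => exact absurd hij (lt_irrefl _)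
    | succ j => simp
  | succ i =>
    cases j using Fin.cases with
    | zero => exact absurd hij (Fin.not_lt_zero _)
    | succ j => simpa using hf (Fin.succ_lt_succ_iff.1 hij)

/-- `f` is the increasing enumeration of `S`. -/
structure Enum {m : ℕ} (S : Finset (Fin p)) (f : Fin m → Fin p) : Prop where
  card_eq : S.card = m
  mem : ∀ i, f i ∈ S
  mono : StrictMono f

theorem enum_orderEmbOfFin {m : ℕ} (S : Finset (Fin p)) (h : S.card = m) :
    Enum S (S.orderEmbOfFin h) :=
  ⟨h, fun i => S.orderEmbOfFin_mem h i, (S.orderEmbOfFin h).strictMono⟩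

theorem Enum.eq {m : ℕ} {S : Finset (Fin p)} {f : Fin m → Fin p} (hf : Enum S f) :
    f = S.orderEmbOfFin hf.card_eq :=
  Finset.orderEmbOfFin_unique hf.card_eq hf.mem hf.mono

theorem Enum.shift {m : ℕ} {S : Finset (Fin p)} {f : Fin m → Fin p} (hf : Enum S f) :
    Enum (shift S) fun i => (f i).succ :=
  ⟨by simpa using hf.card_eq, fun i => by simpa using hf.mem i, strictMono_succ_comp hf.mono⟩

theorem Enum.shift0 {m : ℕ} {S : Finset (Fin p)} {f : Fin m → Fin p} (hf : Enum S f) :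
    Enum (shift0 S) (Fin.cons 0 fun i => (f i).succ : Fin (m + 1) → Fin (p + 1)) :=
  ⟨by rw [card_shift0, hf.card_eq], fun i => by
    cases i using Fin.cases with
    | zero => simp
    | succ i => simpa using hf.mem i, strictMono_cons_zero hf.mono⟩

end Subsets

/-! ### Prepending a letter -/

section Cons

variable {K V : Type*} [Field K] [AddCommGroup V] [Module K V]

/-- The map `y ↦ u ⊗ y` on `T(V)` that prepends the letter `u`. -/
def cons (u : V) : Module.End K (T K V) :=
  ofWords fun p => (word K (p + 2)).curryLeft u

theorem cons_word (u : V) (p : ℕ) (v : Fin (p + 1) → V) :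
    cons u (word K (p + 1) v) = word K (p + 2) (Fin.cons u v : Fin (p + 2) → V) := by
  rw [cons, ofWords_word]
  rfl

theorem word_succ_succ (p : ℕ) (v : Fin (p + 2) → V) :
    word K (p + 2) v = cons (v 0) (word K (p + 1) (Fin.tail v)) := by
  rw [cons_word, Fin.cons_self_tail]

theorem cons_word_of_pos {p : ℕ} (hp : 0 < p) (u : V) (v : Fin p → V) :
    cons u (word K p v) = word K (p + 1) (Fin.cons u v : Fin (p + 1) → V) := by
  obtain ⟨p, rfl⟩ := Nat.exists_eq_succ_of_ne_zero hp.ne'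
  exact cons_word u p v

variable {n : ℕ} (𝒱 : Deg n → Submodule K V)

theorem cons_hasWeight {α : Deg n} {u : V} (hu : u ∈ 𝒱 α) : HasWeight 𝒱 α (cons u) := by
  intro β
  have h : tensorGrading 𝒱 β ≤ (tensorGrading 𝒱 (β + α)).comap (cons (K := K) u) := by
    refine Submodule.span_le.2 ?_
    rintro _ ⟨p, d, v, hv, rfl, rfl⟩
    simp only [Submodule.comap_coe, Set.mem_preimage, SetLike.mem_coe, cons_word]
    have := word_mem 𝒱 (Fin.cons α d : Fin (p + 2) → Deg n) (Fin.cons u v : Fin (p + 2) → V)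
      (fun i => by cases i using Fin.cases <;> simp [hu, hv])
    rwa [Fin.sum_univ_succ, Fin.cons_zero, add_comm] at this
  exact h

variable [DirectSum.Decomposition 𝒱]

/-- Linear maps on `T(V)` that agree on words with homogeneous letters are equal. -/
theorem ext_homogeneous_words {W : Type*} [AddCommGroup W] [Module K W] {f g : T K V →ₗ[K] W}
    (h : ∀ (p : ℕ) (d : Fin (p + 1) → Deg n) (v : Fin (p + 1) → V), (∀ i, v i ∈ 𝒱 (d i)) →
      f (word K (p + 1) v) = g (word K (p + 1) v)) : f = g := by
  refine ext_words fun p v => ?_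
  have := ext_homogeneous 𝒱 (f := f.compMultilinearMap (word K (p + 1)))
    (g := g.compMultilinearMap (word K (p + 1))) (h p)
  exact congrArg (fun F => F v) this

/-- To prove that two linear maps on `T(V)` agree, one may prepend homogeneous letters one by
one. -/
theorem ext_cons {W : Type*} [AddCommGroup W] [Module K W] {f g : T K V →ₗ[K] W}
    (h1 : ∀ (α : Deg n) (u : V), u ∈ 𝒱 α → f (word K 1 fun _ => u) = g (word K 1 fun _ => u))
    (h2 : ∀ (α : Deg n) (u : V), u ∈ 𝒱 α → ∀ y, f y = g y → f (cons u y) = g (cons u y)) :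
    f = g := by
  refine ext_homogeneous_words 𝒱 fun p => ?_
  induction p with
  | zero =>
    intro d v hv
    rw [show v = fun _ => v 0 from funext fun i => by rw [Subsingleton.elim (α := Fin 1) i 0]]
    exact h1 _ _ (hv 0)
  | succ p ih =>
    intro d v hv
    rw [word_succ_succ]
    exact h2 _ _ (hv 0) _ (ih (Fin.tail d) (Fin.tail v) fun i => hv i.succ)

end Cons

/-! ### Koszul signs of shifted subsets -/

section Signs

variable {n p : ℕ}

theorem koszul_shift0_shift (d : Fin (p + 1) → Deg n) (I J : Finset (Fin p)) :
    koszul d (shift0 I) (shift J) = koszul (Fin.tail d) I J := by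
  simp [koszul, Finset.prod_insert (zero_notMem_shift I), Finset.prod_map, Finset.filter_map,
    Function.comp_def, Fin.tail]

theorem insertSign_of_enum {a : ℕ} (D : Deg n) {S : Finset (Fin p)} (hS : S.card = a + 1)
    {f : Fin (a + 1) → Fin p} (hf : Enum S f) (d : Fin p → Deg n) :
    insertSign D S hS d = koszul d (Sᶜ.filter (· < f (Fin.last a))) (S.erase (f (Fin.last a))) *
      sgn D (∑ i ∈ Sᶜ.filter (· < f (Fin.last a)), d i) := by
  rw [hf.eq]
  rfl

theorem filter_shift_lt (S : Finset (Fin p)) (k : Fin p) :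
    (shift S).filter (· < k.succ) = shift (S.filter (· < k)) := by
  ext j
  cases j using Fin.cases <;> simp

theorem filter_shift0_lt (S : Finset (Fin p)) (k : Fin p) :
    (shift0 S).filter (· < k.succ) = shift0 (S.filter (· < k)) := by
  ext j
  cases j using Fin.cases <;> simp

theorem koszul_shift_shift0 (d : Fin (p + 1) → Deg n) (I J : Finset (Fin p)) :
    koszul d (shift I) (shift0 J) = sgn (d 0) (∑ i ∈ I, Fin.tail d i) *
      koszul (Fin.tail d) I J := by
  rw [koszul, koszul, Finset.prod_map, sgn_sum_right, ← Finset.prod_mul_distrib]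
  refine Finset.prod_congr rfl fun i _ => ?_
  change ∏ j ∈ (shift0 J).filter (· < i.succ), sgn (d i.succ) (d j) = _
  rw [filter_shift0_lt, Finset.prod_insert (zero_notMem_shift _), Finset.prod_map, sgn_comm]
  rfl

theorem erase_shift (S : Finset (Fin p)) (k : Fin p) :
    (shift S).erase k.succ = shift (S.erase k) := by
  ext j
  cases j using Fin.cases <;> simp

theorem erase_shift0 (S : Finset (Fin p)) (k : Fin p) :
    (shift0 S).erase k.succ = shift0 (S.erase k) := by
  ext j
  cases j using Fin.cases <;> simp [(Fin.succ_ne_zero _).symm]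

theorem insertSign_shift {a : ℕ} (D : Deg n) (S : Finset (Fin p)) (hS : S.card = a + 1)
    (hS' : (shift S).card = a + 1) (d : Fin (p + 1) → Deg n) :
    insertSign D (shift S) hS' d = sgn D (d 0) * insertSign D S hS (Fin.tail d) := by
  have hf := enum_orderEmbOfFin S hS
  rw [insertSign_of_enum D hS hf, insertSign_of_enum D hS' hf.shift, compl_shift,
    filter_shift0_lt, erase_shift, koszul_shift0_shift,
    Finset.sum_insert (zero_notMem_shift _), Finset.sum_map, sgn_add_right]
  exact mul_left_comm _ _ _

theorem insertSign_shift0 {a : ℕ} (D : Deg n) (S : Finset (Fin p)) (hS : S.card = a + 1)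
    (hS' : (shift0 S).card = a + 2) (d : Fin (p + 1) → Deg n) :
    insertSign D (shift0 S) hS' d = insertSign (D + d 0) S hS (Fin.tail d) := by
  have hf := enum_orderEmbOfFin S hS
  rw [insertSign_of_enum _ hS hf, insertSign_of_enum D hS' hf.shift0, compl_shift0,
    ← Fin.succ_last, Fin.cons_succ, filter_shift_lt, erase_shift0, koszul_shift_shift0,
    Finset.sum_map, sgn_add_left, mul_comm (sgn (d 0) _), mul_assoc, mul_comm (sgn D _)]
  rfl

theorem insertSign_shift0_empty (D : Deg n) (hS : (shift0 (∅ : Finset (Fin p))).card = 0 + 1)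
    (d : Fin (p + 1) → Deg n) : insertSign D (shift0 ∅) hS d = 1 := by
  have hf : Enum (shift0 (∅ : Finset (Fin p))) (fun _ : Fin 1 => (0 : Fin (p + 1))) :=
    ⟨hS, fun i => by simp, Subsingleton.strictMono _⟩
  rw [insertSign_of_enum D hS hf]
  simp [koszul]

end Signs

/-! ### Recursions for the coproduct and for extensions -/

section Recursion

variable {K V : Type*} [Field K] [AddCommGroup V] [Module K V]

theorem insertAt_of_enum {p a c : ℕ} {S : Finset (Fin p)} (hS : S.card = a + 1)
    {f : Fin (a + 1) → Fin p} (hf : Enum S f) {g : Fin c → Fin p} (hg : Enum Sᶜ g)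
    (r : Fin (c + 1)) (hr : (r : ℕ) = (Sᶜ.filter (· < f (Fin.last a))).card)
    (q : MultilinearMap K (fun _ : Fin (a + 1) => V) V) (v : Fin p → V) :
    insertAt S hS q v = word K (c + 1) (r.insertNth (α := fun _ => V)
      (q fun i => v (f i)) fun i => v (g i)) := by
  obtain rfl := hg.card_eq
  obtain rfl : r = numBefore S hS := Fin.ext (by rw [hr, hf.eq]; rfl)
  rw [insertAt_apply, ← hf.eq, ← hg.eq]

theorem split_of_enum {p b c : ℕ} {I : Finset (Fin p)} {f : Fin b → Fin p} (hf : Enum I f)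
    {g : Fin c → Fin p} (hg : Enum Iᶜ g) (v : Fin p → V) :
    split (K := K) I v = word K b (fun i => v (f i)) ⊗ₜ[K] word K c (fun i => v (g i)) := by
  obtain rfl := hf.card_eq
  obtain rfl := hg.card_eq
  rw [split_apply, ← hf.eq, ← hg.eq]

theorem insertAt_shift {p a : ℕ} (S : Finset (Fin p)) (hS : S.card = a + 1)
    (hS' : (shift S).card = a + 1) (q : MultilinearMap K (fun _ : Fin (a + 1) => V) V)
    (v : Fin (p + 1) → V) :
    insertAt (shift S) hS' q v = cons (v 0) (insertAt S hS q (Fin.tail v)) := by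
  have hf := enum_orderEmbOfFin S hS
  have hg := enum_orderEmbOfFin Sᶜ rfl
  rw [insertAt_of_enum hS hf hg (numBefore S hS) rfl,
    insertAt_of_enum hS' hf.shift (by simpa only [compl_shift] using hg.shift0)
      (numBefore S hS).succ
      (by rw [compl_shift, filter_shift0_lt, card_shift0, Fin.val_succ]; rfl), cons_word]
  rw [← Fin.insertNth_succ_cons]
  congr 2
  funext i
  cases i using Fin.cases <;> simp [Fin.tail]

theorem insertAt_shift0 {p a : ℕ} (S : Finset (Fin p)) (hS : S.card = a + 1)
    (hS' : (shift0 S).card = a + 2) (q : MultilinearMap K (fun _ : Fin (a + 2) => V) V)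
    (v : Fin (p + 1) → V) :
    insertAt (shift0 S) hS' q v = insertAt S hS (q.curryLeft (v 0)) (Fin.tail v) := by
  have hf := enum_orderEmbOfFin S hS
  have hg := enum_orderEmbOfFin Sᶜ rfl
  rw [insertAt_of_enum hS hf hg (numBefore S hS) rfl,
    insertAt_of_enum hS' hf.shift0 (by simpa only [compl_shift0] using hg.shift)
      (numBefore S hS)
      (by rw [compl_shift0, ← Fin.succ_last, Fin.cons_succ, filter_shift_lt, Finset.card_map]
          rfl)]
  congr 2
  rw [MultilinearMap.curryLeft_apply]
  congr 1
  funext i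
  cases i using Fin.cases <;> simp [Fin.tail]

theorem insertAt_shift0_empty {p : ℕ} (hS : (shift0 (∅ : Finset (Fin p))).card = 0 + 1)
    (q : MultilinearMap K (fun _ : Fin 1 => V) V) (v : Fin (p + 1) → V) :
    insertAt (shift0 ∅) hS q v =
      word K (p + 1) (Fin.cons (q fun _ => v 0) (Fin.tail v) : Fin (p + 1) → V) := by
  have hf : Enum (shift0 (∅ : Finset (Fin p))) (fun _ : Fin 1 => (0 : Fin (p + 1))) :=
    ⟨hS, fun i => by simp, Subsingleton.strictMono _⟩
  have hg : Enum (shift0 (∅ : Finset (Fin p)))ᶜ (Fin.succ : Fin p → Fin (p + 1)) :=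
    ⟨by simp, fun i => by simp, Fin.strictMono_succ⟩
  rw [insertAt_of_enum hS hf hg 0 (by simp), Fin.insertNth_zero']
  rfl

theorem sum_subtype_eq_sum_dite {ι M : Type*} [Fintype ι] [AddCommMonoid M] (P : ι → Prop)
    [DecidablePred P] (F : ∀ i, P i → M) :
    ∑ s : {i // P i}, F s.1 s.2 = ∑ i, if h : P i then F i h else 0 := by
  rw [← Fintype.sum_subtype_add_sum_subtype P fun i => if h : P i then F i h else 0,
    Finset.sum_eq_zero (s := (Finset.univ : Finset {i // ¬ P i})) fun i _ => dif_neg i.2, add_zero]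
  exact Finset.sum_congr rfl fun i _ => (dif_pos i.2).symm

theorem map_units_smul {M N : Type*} [AddCommGroup M] [Module K M] [AddCommGroup N] [Module K N]
    (f : M →ₗ[K] N) (u : ℤˣ) (x : M) : f (u • x) = u • f x := by
  rw [Units.smul_def, Units.smul_def, map_zsmul]

theorem units_smul_tmul {M N : Type*} [AddCommGroup M] [Module K M] [AddCommGroup N] [Module K N]
    (u : ℤˣ) (x : M) (y : N) : (u • x) ⊗ₜ[K] y = u • x ⊗ₜ[K] y :=
  map_units_smul ((TensorProduct.mk K M N).flip y) u x

variable {n : ℕ} (𝒱 : Deg n → Submodule K V) [DirectSum.Decomposition 𝒱]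

theorem extend_word (D : Deg n) {a p : ℕ} (q : MultilinearMap K (fun _ : Fin (a + 1) => V) V)
    (d : Fin (p + 1) → Deg n) (v : Fin (p + 1) → V) (hv : ∀ i, v i ∈ 𝒱 (d i)) :
    extend 𝒱 D q (word K (p + 1) v) = ∑ S : Finset (Fin (p + 1)),
      if h : S.card = a + 1 then insertSign D S h d • insertAt S h q v else 0 := by
  rw [extend, ofWords_word, sum_apply, ← sum_subtype_eq_sum_dite]
  exact Finset.sum_congr rfl fun S _ => signed_apply 𝒱 _ _ d v hv

theorem extend_word_one_succ (D : Deg n) {a : ℕ}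
    (q : MultilinearMap K (fun _ : Fin (a + 2) => V) V) {α : Deg n} {u : V} (hu : u ∈ 𝒱 α) :
    extend 𝒱 D q (word K 1 fun _ => u) = 0 := by
  rw [extend_word 𝒱 D q (fun _ => α) _ fun _ => hu]
  refine Finset.sum_eq_zero fun S _ => dif_neg fun h => ?_
  have := S.card_le_univ
  simp at this
  omega

theorem extend_word_one_zero (D : Deg n)
    (q : MultilinearMap K (fun _ : Fin 1 => V) V) {α : Deg n} {u : V} (hu : u ∈ 𝒱 α) :
    extend 𝒱 D q (word K 1 fun _ => u) = word K 1 fun _ => q fun _ => u := by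
  rw [extend_word 𝒱 D q (fun _ => α) _ fun _ => hu, sum_finset_fin_succ]
  simp only [Fintype.sum_subsingleton _ (∅ : Finset (Fin 0))]
  rw [dif_neg (by simp), zero_add, dif_pos (by simp), insertSign_shift0_empty,
    insertAt_shift0_empty, one_smul]
  congr 1
  funext i
  rw [Subsingleton.elim (α := Fin 1) i 0]
  rfl

/-- Moving an extension of a multilinear map past the first letter: either the letter stays in
front, or it is fed to the multilinear map. -/
theorem extend_cons_succ (D : Deg n) {a : ℕ}
    (q : MultilinearMap K (fun _ : Fin (a + 2) => V) V) {α : Deg n} {u : V} (hu : u ∈ 𝒱 α) :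
    extend 𝒱 D q ∘ₗ cons u =
      sgn D α • (cons u ∘ₗ extend 𝒱 D q) + extend 𝒱 (D + α) (q.curryLeft u) := by
  refine ext_homogeneous_words 𝒱 fun p d v hv => ?_
  simp only [LinearMap.comp_apply, LinearMap.add_apply, LinearMap.smul_apply]
  rw [cons_word, extend_word 𝒱 D q (Fin.cons α d : Fin (p + 2) → Deg n) _
    fun i => by cases i using Fin.cases <;> simp [hu, hv], sum_finset_fin_succ,
    extend_word 𝒱 D q d v hv, extend_word 𝒱 _ _ d v hv, map_sum, Finset.smul_sum]
  congr 1
  · refine Finset.sum_congr rfl fun S _ => ?_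
    by_cases h : S.card = a + 2
    · rw [dif_pos (by simpa using h), dif_pos h, insertAt_shift S h, insertSign_shift D S h,
        map_units_smul, smul_smul]
      rfl
    · rw [dif_neg (by simpa using h), dif_neg h, map_zero, smul_zero]
  · refine Finset.sum_congr rfl fun S _ => ?_
    by_cases h : S.card = a + 1
    · rw [dif_pos (by rw [card_shift0, h]), dif_pos h, insertAt_shift0 S h, insertSign_shift0 D S h]
      rfl
    · rw [dif_neg (by rw [card_shift0]; omega), dif_neg h]

/-- Moving the extension of a linear map past the first letter. -/
theorem extend_cons_zero (D : Deg n)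
    (q : MultilinearMap K (fun _ : Fin 1 => V) V) {α : Deg n} {u : V} (hu : u ∈ 𝒱 α) :
    extend 𝒱 D q ∘ₗ cons u =
      sgn D α • (cons u ∘ₗ extend 𝒱 D q) + cons (q fun _ => u) := by
  refine ext_homogeneous_words 𝒱 fun p d v hv => ?_
  simp only [LinearMap.comp_apply, LinearMap.add_apply, LinearMap.smul_apply]
  rw [cons_word, extend_word 𝒱 D q (Fin.cons α d : Fin (p + 2) → Deg n) _
    fun i => by cases i using Fin.cases <;> simp [hu, hv], sum_finset_fin_succ,
    extend_word 𝒱 D q d v hv, map_sum, Finset.smul_sum]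
  congr 1
  · refine Finset.sum_congr rfl fun S _ => ?_
    by_cases h : S.card = 0 + 1
    · rw [dif_pos (by simpa using h), dif_pos h, insertAt_shift S h, insertSign_shift D S h,
        map_units_smul, smul_smul]
      rfl
    · rw [dif_neg (by simpa using h), dif_neg h, map_zero, smul_zero]
  · rw [Finset.sum_eq_single ∅ (fun S _ hS => dif_neg (by rw [card_shift0]; simpa using hS))
      (by simp), dif_pos (by simp), insertSign_shift0_empty, insertAt_shift0_empty, one_smul,
      cons_word]
    simp

theorem coproduct_word {p : ℕ} (d : Fin (p + 1) → Deg n) (v : Fin (p + 1) → V)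
    (hv : ∀ i, v i ∈ 𝒱 (d i)) :
    coproduct 𝒱 (word K (p + 1) v) = ∑ I : Finset (Fin (p + 1)),
      if I.Nonempty ∧ Fin.last p ∉ I then koszul d I Iᶜ • split (K := K) I v else 0 := by
  rw [coproduct, ofWords_word, sum_apply]
  refine Eq.trans (Finset.sum_congr rfl fun I _ => signed_apply 𝒱 _ _ d v hv) ?_
  exact sum_subtype_eq_sum_dite _ fun I _ => koszul d I Iᶜ • split (K := K) I v

theorem coproduct_word_one {α : Deg n} {u : V} (hu : u ∈ 𝒱 α) :
    coproduct 𝒱 (word K 1 fun _ => u) = 0 := by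
  rw [coproduct_word 𝒱 (fun _ => α) _ fun _ => hu]
  refine Finset.sum_eq_zero fun I _ => if_neg ?_
  rintro ⟨⟨i, hi⟩, h⟩
  obtain rfl : i = Fin.last 0 := Subsingleton.elim (α := Fin 1) _ _
  exact h hi

theorem parity_word (D : Deg n) {p : ℕ} (d : Fin p → Deg n) (v : Fin p → V)
    (hv : ∀ i, v i ∈ 𝒱 (d i)) :
    parity 𝒱 D (word K p v) = sgn D (∑ i, d i) • word K p v := by
  cases p with
  | zero => simp [word]
  | succ p =>
    rw [parity, ofWords_word]
    exact signed_apply 𝒱 _ _ d v hv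

theorem parity_zero : parity (K := K) 𝒱 0 = LinearMap.id :=
  ext_homogeneous_words 𝒱 fun p d v hv => by
    rw [parity_word 𝒱 0 d v hv, sgn_zero_left, one_smul, LinearMap.id_apply]

theorem koszulMap_zero_tmul (f g : Module.End K (T K V)) (x y : T K V) :
    koszulMap 𝒱 0 f g (x ⊗ₜ y) = f x ⊗ₜ g y := by
  simp [koszulMap, parity_zero]

theorem koszulMap_id_tmul (D : Deg n) (g : Module.End K (T K V)) (x y : T K V) :
    koszulMap 𝒱 D LinearMap.id g (x ⊗ₜ y) = parity 𝒱 D x ⊗ₜ g y := by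
  simp [koszulMap]

/-- Prepending a letter `u` is a coderivation of the coproduct, up to the term `u ⊗ y`. -/
theorem coproduct_cons {α : Deg n} {u : V} (hu : u ∈ 𝒱 α) (y : T K V) :
    coproduct 𝒱 (cons u y) = (word K 1 fun _ => u) ⊗ₜ y +
      (koszulMap 𝒱 0 (cons u) LinearMap.id (coproduct 𝒱 y) +
        koszulMap 𝒱 α LinearMap.id (cons u) (coproduct 𝒱 y)) := by
  suffices h : coproduct 𝒱 ∘ₗ cons u = TensorProduct.mk K _ _ (word K 1 fun _ => u) +
      (koszulMap 𝒱 0 (cons u) LinearMap.id ∘ₗ coproduct 𝒱 +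
        koszulMap 𝒱 α LinearMap.id (cons u) ∘ₗ coproduct 𝒱) from LinearMap.congr_fun h y
  refine ext_homogeneous_words 𝒱 fun p d v hv => ?_
  simp only [LinearMap.comp_apply, LinearMap.add_apply, TensorProduct.mk_apply]
  rw [cons_word, coproduct_word 𝒱 (Fin.cons α d : Fin (p + 2) → Deg n) _
    fun i => by cases i using Fin.cases <;> simp [hu, hv], sum_finset_fin_succ,
    coproduct_word 𝒱 d v hv, map_sum, map_sum, ← add_assoc,
    add_comm (∑ S, (if (shift S).Nonempty ∧ _ then _ else _))]
  congr 1
  · have h0 : (word K 1 fun _ => u) ⊗ₜ[K] word K (p + 1) v =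
        ∑ S : Finset (Fin (p + 1)), if S = ∅ then
          (word K 1 fun _ => u) ⊗ₜ[K] word K (p + 1) v else 0 := by simp
    rw [h0, ← Finset.sum_add_distrib]
    refine Finset.sum_congr rfl fun S _ => ?_
    have hl : (shift0 S).Nonempty ∧ Fin.last (p + 1) ∉ shift0 S ↔ Fin.last p ∉ S := by
      rw [← Fin.succ_last]
      simp
    simp only [hl]
    rw [compl_shift0, koszul_shift0_shift, Fin.tail_cons]
    rcases S.eq_empty_or_nonempty with rfl | hne
    · have hf : Enum (∅ : Finset (Fin (p + 1))) (Fin.elim0 : Fin 0 → Fin (p + 1)) :=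
        ⟨rfl, fun i => i.elim0, fun i => i.elim0⟩
      have hg : Enum (∅ : Finset (Fin (p + 1)))ᶜ (id : Fin (p + 1) → Fin (p + 1)) :=
        ⟨by simp, by simp, strictMono_id⟩
      rw [split_of_enum hf.shift0 (by simpa only [compl_shift0] using hg.shift)]
      simp only [Finset.notMem_empty, not_false_eq_true, if_true, Finset.not_nonempty_empty,
        false_and, if_false, map_zero, add_zero]
      rw [show koszul d ∅ ∅ᶜ = 1 by simp [koszul], one_smul]
      congr 2
      funext i
      rw [Subsingleton.elim (α := Fin 1) i 0]
      rfl
    · rw [if_neg hne.ne_empty, zero_add]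
      by_cases h : Fin.last p ∈ S
      · simp [h]
      · have hf := enum_orderEmbOfFin S rfl
        have hg := enum_orderEmbOfFin Sᶜ rfl
        rw [if_pos h, if_pos ⟨hne, h⟩, map_units_smul, split_of_enum hf hg,
          split_of_enum hf.shift0 (by simpa only [compl_shift0] using hg.shift),
          koszulMap_zero_tmul, cons_word_of_pos hne.card_pos, LinearMap.id_apply]
        congr 3
        funext i
        cases i using Fin.cases <;> simp
  · refine Finset.sum_congr rfl fun S _ => ?_
    have hl : (shift S).Nonempty ∧ Fin.last (p + 1) ∉ shift S ↔
        S.Nonempty ∧ Fin.last p ∉ S := by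
      rw [← Fin.succ_last]
      simp
    simp only [hl]
    by_cases h : S.Nonempty ∧ Fin.last p ∉ S
    · have hf := enum_orderEmbOfFin S rfl
      have hg := enum_orderEmbOfFin Sᶜ rfl
      have hc : 0 < Sᶜ.card := Finset.card_pos.2 ⟨Fin.last p, by simpa using h.2⟩
      have hs : ∑ i, d (S.orderEmbOfFin rfl i) = ∑ i ∈ S, d i := by
        rw [← Finset.sum_coe_sort S d, ← (S.orderIsoOfFin rfl).toEquiv.sum_comp]
        rfl
      rw [if_pos h, if_pos h, compl_shift, koszul_shift_shift0, map_units_smul,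
        split_of_enum hf hg, split_of_enum hf.shift (by simpa only [compl_shift] using hg.shift0),
        koszulMap_id_tmul, parity_word 𝒱 _ _ _ fun i => hv (S.orderEmbOfFin rfl i),
        cons_word_of_pos hc, hs, Fin.tail_cons, Fin.cons_zero, mul_comm, ← smul_smul,
        units_smul_tmul]
      congr 4
      funext i
      cases i using Fin.cases <;> simp
    · rw [if_neg h, if_neg h, map_zero]

end Recursion

/-! ### Operators on `T(V) ⊗ T(V)` and coderivations -/

section Coderivations

variable {K V : Type*} [Field K] [AddCommGroup V] [Module K V]
variable {n : ℕ} (𝒱 : Deg n → Submodule K V) [DirectSum.Decomposition 𝒱]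

theorem parity_of_mem (D : Deg n) {α : Deg n} {x : T K V} (hx : x ∈ tensorGrading 𝒱 α) :
    parity 𝒱 D x = sgn D α • x := by
  refine Submodule.span_induction ?_ ?_ ?_ ?_ hx
  · rintro _ ⟨p, d, v, hv, rfl, rfl⟩
    exact parity_word 𝒱 D d v hv
  · simp
  · intro x y _ _ hx hy
    rw [map_add, hx, hy, smul_add]
  · intro c x _ hx
    rw [map_smul, hx, smul_comm]

theorem parity_apply_of_hasWeight (D : Deg n) {E : Deg n} {Q : Module.End K (T K V)}
    (hQ : HasWeight 𝒱 E Q) (x : T K V) :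
    parity 𝒱 D (Q x) = sgn D E • Q (parity 𝒱 D x) := by
  suffices h : parity 𝒱 D ∘ₗ Q = sgn D E • (Q ∘ₗ parity 𝒱 D) from LinearMap.congr_fun h x
  refine ext_homogeneous_words 𝒱 fun p d v hv => ?_
  have hw := word_mem 𝒱 d v hv
  simp only [LinearMap.comp_apply, LinearMap.smul_apply]
  rw [parity_of_mem 𝒱 D (hQ _ _ hw), parity_of_mem 𝒱 D hw, map_units_smul, smul_smul,
    sgn_add_right, mul_comm]

theorem parity_parity (D E : Deg n) (x : T K V) :
    parity 𝒱 D (parity 𝒱 E x) = parity 𝒱 (D + E) x := by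
  suffices h : parity 𝒱 D ∘ₗ parity 𝒱 E = parity (K := K) 𝒱 (D + E) from LinearMap.congr_fun h x
  refine ext_homogeneous_words 𝒱 fun p d v hv => ?_
  rw [LinearMap.comp_apply, parity_word 𝒱 _ d v hv, map_units_smul, parity_word 𝒱 _ d v hv,
    parity_word 𝒱 _ d v hv, smul_smul, sgn_add_left, mul_comm]

/-- The operator `P ⊗ id` on `T(V) ⊗ T(V)`. -/
abbrev onLeft (P : Module.End K (T K V)) : Module.End K (T K V ⊗[K] T K V) :=
  koszulMap 𝒱 0 P LinearMap.id

/-- The operator `id ⊗ P` on `T(V) ⊗ T(V)`, where `P` has weight `D`. -/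
abbrev onRight (D : Deg n) (P : Module.End K (T K V)) : Module.End K (T K V ⊗[K] T K V) :=
  koszulMap 𝒱 D LinearMap.id P

theorem onLeft_add (P R : Module.End K (T K V)) :
    onLeft 𝒱 (P + R) = onLeft 𝒱 P + onLeft 𝒱 R :=
  TensorProduct.ext' fun x y => by
    simp only [koszulMap_zero_tmul, LinearMap.add_apply, TensorProduct.add_tmul]

theorem onLeft_smul (u : ℤˣ) (P : Module.End K (T K V)) :
    onLeft 𝒱 (u • P) = u • onLeft 𝒱 P :=
  TensorProduct.ext' fun x y => by
    simp only [koszulMap_zero_tmul, LinearMap.smul_apply, units_smul_tmul]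

theorem onRight_add (D : Deg n) (P R : Module.End K (T K V)) :
    onRight 𝒱 D (P + R) = onRight 𝒱 D P + onRight 𝒱 D R :=
  TensorProduct.ext' fun x y => by
    simp only [koszulMap_id_tmul, LinearMap.add_apply, TensorProduct.tmul_add]

theorem onRight_smul (D : Deg n) (u : ℤˣ) (P : Module.End K (T K V)) :
    onRight 𝒱 D (u • P) = u • onRight 𝒱 D P :=
  TensorProduct.ext' fun x y => by
    simp only [koszulMap_id_tmul, LinearMap.smul_apply]
    exact map_units_smul (TensorProduct.mk K _ _ (parity 𝒱 D x)) u (P y)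

theorem onLeft_comp (P R : Module.End K (T K V)) :
    onLeft 𝒱 (P ∘ₗ R) = onLeft 𝒱 P ∘ₗ onLeft 𝒱 R :=
  TensorProduct.ext' fun x y => by simp [koszulMap_zero_tmul]

theorem onRight_comp (D E : Deg n) (P R : Module.End K (T K V)) :
    onRight 𝒱 (D + E) (P ∘ₗ R) = onRight 𝒱 D P ∘ₗ onRight 𝒱 E R :=
  TensorProduct.ext' fun x y => by simp [koszulMap_id_tmul, parity_parity]

/-- Operators on the two tensor factors commute up to the sign given by their weights. -/
theorem onRight_comp_onLeft {D : Deg n} (E : Deg n) {P : Module.End K (T K V)}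
    (hP : HasWeight 𝒱 D P) (R : Module.End K (T K V)) :
    onRight 𝒱 E R ∘ₗ onLeft 𝒱 P = sgn E D • (onLeft 𝒱 P ∘ₗ onRight 𝒱 E R) :=
  TensorProduct.ext' fun x y => by
    simp only [LinearMap.comp_apply, LinearMap.smul_apply, koszulMap_id_tmul, koszulMap_zero_tmul,
      LinearMap.id_apply, parity_apply_of_hasWeight 𝒱 E hP, units_smul_tmul]

/-- The induction step for `extend_isCoderivation`: if `Q` passes the first letter up to an operator
`Q'` that satisfies the coderivation identity, with an extra term, for all arguments, then `Q`
satisfies the coderivation identity. -/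
theorem coproduct_comp_of_cons {D : Deg n} {Q : Module.End K (T K V)} (hQ : HasWeight 𝒱 D Q)
    (h1 : ∀ (α : Deg n) (u : V), u ∈ 𝒱 α → coproduct 𝒱 (Q (word K 1 fun _ => u)) = 0)
    (hcons : ∀ (α : Deg n) (u : V), u ∈ 𝒱 α → ∃ Q' : Module.End K (T K V),
      Q ∘ₗ cons u = sgn D α • (cons u ∘ₗ Q) + Q' ∧
      ∀ y, coproduct 𝒱 (Q' y) = Q (word K 1 fun _ => u) ⊗ₜ y +
        (onLeft 𝒱 Q' + onRight 𝒱 (D + α) Q') (coproduct 𝒱 y)) :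
    coproduct 𝒱 ∘ₗ Q = (onLeft 𝒱 Q + onRight 𝒱 D Q) ∘ₗ coproduct 𝒱 := by
  refine ext_cons 𝒱 (fun α u hu => ?_) fun α u hu y ih => ?_
  · simp only [LinearMap.comp_apply]
    rw [h1 α u hu, coproduct_word_one 𝒱 hu, map_zero]
  · obtain ⟨Q', hQ', hc⟩ := hcons α u hu
    simp only [LinearMap.comp_apply] at ih ⊢
    have hl := onLeft_comp 𝒱 Q (cons u)
    have hr := onRight_comp 𝒱 D α Q (cons u)
    rw [hQ', onLeft_add, onLeft_smul, onLeft_comp] at hl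
    rw [hQ', onRight_add, onRight_smul, add_comm D α, onRight_comp, add_comm α D] at hr
    have hl' := LinearMap.congr_fun hl (coproduct 𝒱 y)
    have hr' := LinearMap.congr_fun hr (coproduct 𝒱 y)
    have h12 := LinearMap.congr_fun (onRight_comp_onLeft 𝒱 α hQ (cons u)) (coproduct 𝒱 y)
    have h21 := LinearMap.congr_fun (onRight_comp_onLeft 𝒱 D (cons_hasWeight 𝒱 hu) Q)
      (coproduct 𝒱 y)
    have hQc := LinearMap.congr_fun hQ' y
    have hw := parity_of_mem 𝒱 D (word_mem 𝒱 (fun _ : Fin 1 => α) (fun _ => u) fun _ => hu)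
    simp only [LinearMap.comp_apply, LinearMap.add_apply, LinearMap.smul_apply]
      at hl' hr' h12 h21 hQc
    rw [hQc, map_add, map_units_smul, coproduct_cons 𝒱 hu, coproduct_cons 𝒱 hu, ih, hc]
    simp only [LinearMap.add_apply, map_add]
    rw [← hl', ← hr', h12, h21, koszulMap_zero_tmul, koszulMap_id_tmul, hw]
    simp only [LinearMap.id_apply, units_smul_tmul, smul_add, smul_smul, sgn_comm α D,
      sgn_mul_self, one_smul]
    simp
    abel

/-- The map `extend D q` is a coderivation. -/
theorem extend_isCoderivation {a : ℕ} {D : Deg n}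
    {q : MultilinearMap K (fun _ : Fin (a + 1) => V) V} (hq : q ∈ Mult 𝒱 (D, a)) :
    IsCoderivation 𝒱 D (extend 𝒱 D q) := by
  refine ⟨extend_hasWeight 𝒱 hq, ?_⟩
  induction a generalizing D with
  | zero =>
    have hmem : ∀ {α : Deg n} {u : V}, u ∈ 𝒱 α → q (fun _ => u) ∈ 𝒱 (D + α) := fun {α u} hu => by
      simpa using hq (fun _ => α) (fun _ => u) fun _ => hu
    refine coproduct_comp_of_cons 𝒱 (extend_hasWeight 𝒱 hq) (fun α u hu => ?_) fun α u hu =>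
      ⟨_, extend_cons_zero 𝒱 D q hu, fun y => ?_⟩
    · rw [extend_word_one_zero 𝒱 D q hu, coproduct_word_one 𝒱 (hmem hu)]
    · rw [extend_word_one_zero 𝒱 D q hu, coproduct_cons 𝒱 (hmem hu)]
      rfl
  | succ a ih =>
    refine coproduct_comp_of_cons 𝒱 (extend_hasWeight 𝒱 hq) (fun α u hu => ?_) fun α u hu =>
      ⟨_, extend_cons_succ 𝒱 D q hu, fun y => ?_⟩
    · rw [extend_word_one_succ 𝒱 D q hu, map_zero]
    · have hq' : q.curryLeft u ∈ Mult 𝒱 (D + α, a) := fun d v hv => by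
        have := hq (Fin.cons α d : Fin (a + 2) → Deg n) (Fin.cons u v : Fin (a + 2) → V)
          fun i => by cases i using Fin.cases <;> simp [hu, hv]
        rwa [Fin.sum_univ_succ, Fin.cons_zero, ← add_assoc] at this
      rw [extend_word_one_succ 𝒱 D q hu, TensorProduct.zero_tmul, zero_add]
      exact LinearMap.congr_fun (ih hq') y

variable {𝒱}

theorem IsCoderivation.sub {D : Deg n} {P Q : Module.End K (T K V)} (hP : IsCoderivation 𝒱 D P)
    (hQ : IsCoderivation 𝒱 D Q) : IsCoderivation 𝒱 D (P - Q) := by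
  refine ⟨fun α x hx => sub_mem (hP.1 α x hx) (hQ.1 α x hx), ?_⟩
  have hl := onLeft_add 𝒱 (P - Q) Q
  have hr := onRight_add 𝒱 D (P - Q) Q
  rw [sub_add_cancel] at hl hr
  rw [LinearMap.comp_sub, hP.2, hQ.2, ← LinearMap.sub_comp]
  change (onLeft 𝒱 P + onRight 𝒱 D P - _) ∘ₗ _ = _
  rw [hl, hr]
  congr 1
  abel

/-- The graded commutator of two coderivations is a coderivation. -/
theorem IsCoderivation.commutator {D E : Deg n} {P Q : Module.End K (T K V)}
    (hP : IsCoderivation 𝒱 D P) (hQ : IsCoderivation 𝒱 E Q) :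
    IsCoderivation 𝒱 (D + E) (commutator D E P Q) := by
  refine ⟨commutator_hasWeight 𝒱 hP.1 hQ.1, ?_⟩
  have hl := onLeft_add 𝒱 (StemBracket.commutator D E P Q) (sgn D E • (Q ∘ₗ P))
  have hr := onRight_add 𝒱 (D + E) (StemBracket.commutator D E P Q) (sgn D E • (Q ∘ₗ P))
  rw [commutator_apply, sub_add_cancel, onLeft_comp, onLeft_smul, onLeft_comp] at hl
  rw [commutator_apply, sub_add_cancel, onRight_comp, onRight_smul, add_comm D E,
    onRight_comp, add_comm E D] at hr
  have hPQ := onRight_comp_onLeft 𝒱 D hQ.1 P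
  have hQP := onRight_comp_onLeft 𝒱 E hP.1 Q
  rw [commutator_apply]
  refine LinearMap.ext fun x => ?_
  have hP2 := fun y => LinearMap.congr_fun hP.2 y
  have hQ2 := fun y => LinearMap.congr_fun hQ.2 y
  have hl' := LinearMap.congr_fun hl (coproduct 𝒱 x)
  have hr' := LinearMap.congr_fun hr (coproduct 𝒱 x)
  have hPQ' := LinearMap.congr_fun hPQ (coproduct 𝒱 x)
  have hQP' := LinearMap.congr_fun hQP (coproduct 𝒱 x)
  simp only [LinearMap.comp_apply, LinearMap.add_apply, LinearMap.sub_apply, LinearMap.smul_apply,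
    map_sub, map_units_smul] at hP2 hQ2 hl' hr' hPQ' hQP' ⊢
  simp only [hP2, hQ2, map_add, hPQ', hQP']
  rw [← sub_eq_iff_eq_add] at hl' hr'
  rw [← hl', ← hr', sgn_comm E D]
  simp only [smul_add, smul_smul, sgn_mul_self, one_smul]
  abel

/-! ### Coderivations are determined by their corestriction maps -/

variable (K V)

/-- The inclusion of `V` in `T(V)` as the space of words of length `1`. -/
def letter : V →ₗ[K] T K V := (MultilinearMap.ofSubsingleton K V (T K V) 0).symm (word K 1)

/-- The map `x ⊗ y ↦ x ⊗ pr(y)` from `T(V) ⊗ T(V)` to `T(V)`. -/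
def concat : T K V ⊗[K] T K V →ₗ[K] T K V :=
  TensorProduct.lift ((ofWords fun p => (word K (p + 2)).curryRight).compl₂ (pr K))

variable {K V}

theorem letter_apply (u : V) : letter K V u = word K 1 fun _ => u := rfl

theorem concat_tmul_word (p : ℕ) (v : Fin (p + 1) → V) (y : T K V) :
    concat K V (word K (p + 1) v ⊗ₜ y) =
      word K (p + 2) (Fin.snoc v (pr K y) : Fin (p + 2) → V) := by
  simp [concat, ofWords_word]

theorem concat_cons_tmul (u : V) (x y : T K V) :
    concat K V (cons u x ⊗ₜ y) = cons u (concat K V (x ⊗ₜ y)) := by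
  suffices h : concat K V ∘ₗ (TensorProduct.mk K _ _).flip y ∘ₗ cons u =
      cons u ∘ₗ concat K V ∘ₗ (TensorProduct.mk K _ _).flip y from LinearMap.congr_fun h x
  refine ext_words fun p v => ?_
  simp only [LinearMap.comp_apply, LinearMap.flip_apply, TensorProduct.mk_apply]
  rw [cons_word, concat_tmul_word, concat_tmul_word, cons_word]
  congr 1
  exact (Fin.cons_snoc_eq_snoc_cons u v (pr K y)).symm

theorem pr_word_of_ne_one {p : ℕ} (hp : p ≠ 1) (v : Fin p → V) : pr K (word K p v) = 0 := by
  match p, hp with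
  | 0, _ => simp [word]
  | 1, h => exact absurd rfl h
  | p + 2, _ => simp [word, pr, T.desc_incl]

theorem pr_cons (u : V) (y : T K V) : pr K (cons u y) = 0 := by
  suffices h : pr K ∘ₗ cons u = 0 from LinearMap.congr_fun h y
  refine ext_words fun p v => ?_
  rw [LinearMap.comp_apply, cons_word, pr_word_of_ne_one (by omega), LinearMap.zero_apply]

variable (𝒱)

/-- The term `(v₁ ⊗ … ⊗ v_{p-1}) ⊗ v_p` of the coproduct determines the word, if `p ≥ 2`. -/
theorem concat_coproduct (y : T K V) :
    concat K V (coproduct 𝒱 y) + letter K V (pr K y) = y := by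
  suffices h : concat K V ∘ₗ coproduct 𝒱 + letter K V ∘ₗ pr K = LinearMap.id from
    LinearMap.congr_fun h y
  refine ext_cons 𝒱 (fun α u hu => ?_) fun α u hu y ih => ?_
  · simp only [LinearMap.add_apply, LinearMap.comp_apply, LinearMap.id_apply]
    rw [coproduct_word_one 𝒱 hu, map_zero, zero_add, pr_word_one, letter_apply]
  · simp only [LinearMap.add_apply, LinearMap.comp_apply, LinearMap.id_apply] at ih ⊢
    have hl : concat K V ∘ₗ onLeft 𝒱 (cons u) = cons u ∘ₗ concat K V :=
      TensorProduct.ext' fun x y => by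
        rw [LinearMap.comp_apply, koszulMap_zero_tmul, concat_cons_tmul]
        rfl
    have hr : concat K V ∘ₗ onRight 𝒱 α (cons u) = 0 :=
      TensorProduct.ext' fun x y => by
        rw [LinearMap.comp_apply, koszulMap_id_tmul, concat, TensorProduct.lift.tmul,
          LinearMap.compl₂_apply, pr_cons, map_zero, LinearMap.zero_apply]
    have hl' := LinearMap.congr_fun hl (coproduct 𝒱 y)
    have hr' := LinearMap.congr_fun hr (coproduct 𝒱 y)
    have hw : concat K V ((word K 1 fun _ => u) ⊗ₜ y) = cons u (letter K V (pr K y)) := by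
      rw [concat_tmul_word, letter_apply, cons_word]
      congr 1
      funext i
      cases i using Fin.cases with
      | zero => rfl
      | succ i =>
        rw [Subsingleton.elim (α := Fin 1) i 0]
        rfl
    simp only [LinearMap.comp_apply, LinearMap.zero_apply] at hl' hr'
    rw [coproduct_cons 𝒱 hu, map_add, map_add, hl', hr', hw, pr_cons, map_zero, add_zero, add_zero,
      ← map_add, add_comm, ih]

variable {𝒱}

theorem IsCoderivation.eq_zero {D : Deg n} {Q : Module.End K (T K V)} (hQ : IsCoderivation 𝒱 D Q)
    (h : ∀ r, 1 ≤ r → corestriction r Q = 0) : Q = 0 := by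
  have hpr : pr K ∘ₗ Q = 0 := ext_words fun p v =>
    congrArg (fun F => F v) (h (p + 1) (by omega))
  refine ext_homogeneous_words 𝒱 fun p => ?_
  induction p using Nat.strong_induction_on with
  | _ p ih =>
    intro d v hv
    have ih' : ∀ {m : ℕ}, m < p + 1 → ∀ (d : Fin m → Deg n) (v : Fin m → V),
        (∀ i, v i ∈ 𝒱 (d i)) → Q (word K m v) = 0 := fun {m} hm d v hv => by
      cases m with
      | zero => simp [word]
      | succ m => exact ih m (by omega) d v hv
    have hc : coproduct 𝒱 (Q (word K (p + 1) v)) = 0 := by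
      refine (LinearMap.congr_fun hQ.2 _).trans ?_
      rw [LinearMap.comp_apply, coproduct_word 𝒱 d v hv, map_sum]
      refine Finset.sum_eq_zero fun I _ => ?_
      by_cases hI : I.Nonempty ∧ Fin.last p ∉ I
      · have hcard := I.card_add_card_compl
        have h1 := hI.1.card_pos
        have h2 : 0 < Iᶜ.card := Finset.card_pos.2 ⟨_, Finset.mem_compl.2 hI.2⟩
        rw [Fintype.card_fin] at hcard
        rw [if_pos hI, map_units_smul, split_apply, LinearMap.add_apply, koszulMap_zero_tmul,
          koszulMap_id_tmul, ih' (by omega) _ _ fun i => hv _, ih' (by omega) _ _ fun i => hv _]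
        simp
      · rw [if_neg hI, map_zero]
    rw [← concat_coproduct 𝒱 (Q _), hc, map_zero, zero_add]
    exact (congrArg _ (LinearMap.congr_fun hpr _)).trans (map_zero _)

theorem IsCoderivation.ext {D : Deg n} {P Q : Module.End K (T K V)} (hP : IsCoderivation 𝒱 D P)
    (hQ : IsCoderivation 𝒱 D Q) (h : ∀ r, 1 ≤ r → corestriction r P = corestriction r Q) :
    P = Q := by
  refine sub_eq_zero.1 ((hP.sub hQ).eq_zero fun r hr => ?_)
  ext v
  have := congrArg (fun F => F v) (h r hr)
  simp only [corestriction, LinearMap.compMultilinearMap_apply, LinearMap.comp_apply] at this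
  simp [corestriction, this]

variable (𝒱)

theorem pr_extend_word {a p : ℕ} (D : Deg n) (q : MultilinearMap K (fun _ : Fin (a + 1) => V) V)
    (h : p ≠ a + 1) (d : Fin p → Deg n) (v : Fin p → V) (hv : ∀ i, v i ∈ 𝒱 (d i)) :
    pr K (extend 𝒱 D q (word K p v)) = 0 := by
  cases p with
  | zero => simp [word]
  | succ p =>
    rw [extend_word 𝒱 D q d v hv, map_sum]
    refine Finset.sum_eq_zero fun S _ => ?_
    by_cases hS : S.card = a + 1
    · have hc := S.card_add_card_compl
      rw [Fintype.card_fin] at hc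
      rw [dif_pos hS, map_units_smul, insertAt_apply, pr_word_of_ne_one (by omega), smul_zero]
    · rw [dif_neg hS, map_zero]

theorem corestriction_extend_of_ne {a r : ℕ} (D : Deg n)
    (q : MultilinearMap K (fun _ : Fin (a + 1) => V) V) (h : r ≠ a + 1) :
    corestriction r (extend 𝒱 D q) = 0 :=
  ext_homogeneous 𝒱 fun d v hv => pr_extend_word 𝒱 D q h d v hv

/-- Extensions of maps of arities `a + 1` and `b + 1` shorten words by `a` and `b` letters, so only
the words of length `a + b + 1` can be sent to a single letter by their composite. -/
theorem corestriction_extend_comp_extend {a b r : ℕ} (D : Deg n) {E : Deg n}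
    (q : MultilinearMap K (fun _ : Fin (a + 1) => V) V)
    {s : MultilinearMap K (fun _ : Fin (b + 1) => V) V} (hs : s ∈ Mult 𝒱 (E, b))
    (h : r ≠ a + b + 1) : corestriction r (extend 𝒱 D q ∘ₗ extend 𝒱 E s) = 0 := by
  refine ext_homogeneous 𝒱 fun d v hv => ?_
  change pr K (extend 𝒱 D q (extend 𝒱 E s (word K r v))) = 0
  cases r with
  | zero => simp [word]
  | succ p =>
    rw [extend_word 𝒱 E s d v hv, map_sum, map_sum]
    refine Finset.sum_eq_zero fun S _ => ?_
    by_cases hS : S.card = b + 1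
    · have hc := S.card_add_card_compl
      rw [Fintype.card_fin] at hc
      rw [dif_pos hS, map_units_smul, map_units_smul, insertAt_apply]
      rw [pr_extend_word 𝒱 D q (by omega) ((numBefore S hS).insertNth (α := fun _ => Deg n)
        (E + ∑ i, d (S.orderEmbOfFin hS i)) fun i => d (Sᶜ.orderEmbOfFin rfl i)) _ fun i => ?_,
        smul_zero]
      cases i using Fin.succAboveCases (numBefore S hS) with
      | x => simpa only [Fin.insertNth_apply_same] using hs _ _ fun i => hv _
      | p i => simpa only [Fin.insertNth_apply_succAbove] using hv _
    · rw [dif_neg hS, map_zero, map_zero]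

end Coderivations

/-! ### Identities of the graded commutator -/

section Commutator

variable {K V : Type*} [Field K] [AddCommGroup V] [Module K V] {n : ℕ}

theorem commutator_skew (D E : Deg n) (P Q : Module.End K (T K V)) :
    commutator D E P Q = -(sgn D E • commutator E D Q P) := by
  rw [commutator_apply, commutator_apply, sgn_comm E D]
  rcases Int.units_eq_one_or (sgn D E) with h | h <;> rw [h] <;> simp

theorem commutator_jacobi (D E F : Deg n) (P Q R : Module.End K (T K V)) :
    commutator D (E + F) P (commutator E F Q R) =
      commutator (D + E) F (commutator D E P Q) R +
        sgn D E • commutator E (D + F) Q (commutator D F P R) := by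
  simp only [commutator_apply, sgn_add_left, sgn_add_right, sgn_comm E D]
  rcases Int.units_eq_one_or (sgn D E) with h1 | h1 <;>
  rcases Int.units_eq_one_or (sgn D F) with h2 | h2 <;>
  rcases Int.units_eq_one_or (sgn E F) with h3 | h3 <;>
  simp only [h1, h2, h3, mul_one, one_smul, Units.neg_smul, LinearMap.comp_sub, LinearMap.sub_comp,
    sub_neg_eq_add, LinearMap.comp_add, LinearMap.add_comp,
    LinearMap.comp_assoc, mul_neg, neg_neg] <;> abel

end Commutator

/-! ### The maps `φ` and the stem bracket -/

section Phi

variable {K V : Type*} [Field K] [AddCommGroup V] [Module K V]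
variable {n : ℕ}

theorem signed_signed {p : ℕ} (𝒱 : Deg n → Submodule K V) [DirectSum.Decomposition 𝒱]
    (s : (Fin p → Deg n) → ℤˣ)
    (f : MultilinearMap K (fun _ : Fin p => V) V) : signed 𝒱 s (signed 𝒱 s f) = f :=
  ext_homogeneous 𝒱 fun d v hv => by
    rw [signed_apply 𝒱 _ _ d v hv, signed_apply 𝒱 _ _ d v hv, smul_smul, Int.units_mul_self,
      one_smul]

variable [NeZero n] (𝒱 : Deg n → Submodule K V) [DirectSum.Decomposition 𝒱]

/-- The weight `A + a e₁` of `φ_{(A,a)}(f)`. -/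
abbrev wt (x : Deg n × ℕ) : Deg n := x.1 + (x.2 : ℤ) • e₁

theorem wt_add (x y : Deg n × ℕ) : wt (x + y) = wt x + wt y := by
  simp only [wt, Prod.fst_add, Prod.snd_add, Nat.cast_add, add_smul]
  abel

theorem wt_zero_one : wt ((0, 1) : Deg n × ℕ) = e₁ := by simp [wt]

theorem sgn_e₁_e₁ : sgn (e₁ : Deg n) e₁ = -1 := by simp [sgn, e₁]

theorem phi_eq_extend (x : Deg n × ℕ) (f : Mult 𝒱 x) :
    ∃ q ∈ Mult (desusp 𝒱) (wt x, x.2), phi 𝒱 x f = extend (desusp 𝒱) (wt x) q :=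
  ⟨_, Submodule.smul_mem _ _ (signed_mem_Mult (x := (wt x, x.2)) (desusp 𝒱) _
    ((mem_Mult_desusp 𝒱 x.1 x.2 _).2 f.2)), rfl⟩

theorem phi_isCoderivation (x : Deg n × ℕ) (f : Mult 𝒱 x) :
    IsCoderivation (desusp 𝒱) (wt x) (phi 𝒱 x f) := by
  obtain ⟨q, hq, h⟩ := phi_eq_extend 𝒱 x f
  rw [h]
  exact extend_isCoderivation _ hq

theorem phi_injective (x : Deg n × ℕ) : Function.Injective (phi 𝒱 x) := fun f g h =>
  Subtype.ext (by rw [← phiInv_phi 𝒱 x f, h, phiInv_phi])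

theorem corestriction_phi_of_ne (x : Deg n × ℕ) (f : Mult 𝒱 x) {r : ℕ} (h : r ≠ x.2 + 1) :
    corestriction r (phi 𝒱 x f) = 0 :=
  corestriction_extend_of_ne _ _ _ h

/-- A coderivation of weight `A + a e₁` with only one corestriction map, the `(a+1)`-st one, is in
the image of `φ_{(A,a)}`. -/
theorem phi_phiInv {x : Deg n × ℕ} {Q : Module.End K (T K V)}
    (hQ : IsCoderivation (desusp 𝒱) (wt x) Q)
    (h : ∀ r, 1 ≤ r → r ≠ x.2 + 1 → corestriction r Q = 0) :
    phi 𝒱 x ⟨phiInv 𝒱 x Q, phiInv_mem 𝒱 x hQ.1⟩ = Q := by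
  refine (phi_isCoderivation 𝒱 x _).ext hQ fun r hr => ?_
  by_cases hrx : r = x.2 + 1
  · subst hrx
    have h1 := phiInv_phi 𝒱 x ⟨phiInv 𝒱 x Q, phiInv_mem 𝒱 x hQ.1⟩
    have h2 := congrArg (signed 𝒱 suspSign) h1
    simp only [phiInv, LinearMap.coe_mk, AddHom.coe_mk] at h2
    rwa [signed_signed, signed_signed] at h2
  · rw [h r hr hrx, corestriction_phi_of_ne 𝒱 x _ hrx]

theorem corestriction_commutator_phi (x y : Deg n × ℕ) (f : Mult 𝒱 x) (g : Mult 𝒱 y) {r : ℕ}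
    (h : r ≠ (x + y).2 + 1) :
    corestriction r (commutator (wt x) (wt y) (phi 𝒱 x f) (phi 𝒱 y g)) = 0 := by
  obtain ⟨q, hq, hf⟩ := phi_eq_extend 𝒱 x f
  obtain ⟨s, hs, hg⟩ := phi_eq_extend 𝒱 y g
  rw [Prod.snd_add] at h
  have h1 := corestriction_extend_comp_extend (desusp 𝒱) (wt x) q hs h
  have h2 := corestriction_extend_comp_extend (desusp 𝒱) (wt y) s hq
    (show r ≠ y.2 + x.2 + 1 by omega)
  rw [hf, hg, commutator_apply]
  ext v
  have h1' := congrArg (fun F => F v) h1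
  have h2' := congrArg (fun F => F v) h2
  simp only [corestriction, LinearMap.compMultilinearMap_apply, LinearMap.comp_apply,
    zero_apply, LinearMap.sub_apply, LinearMap.smul_apply, map_sub,
    map_units_smul] at h1' h2' ⊢
  rw [h1', h2', smul_zero, sub_zero]

/-- The sign `(-1)^⟨a e₁, b e₁ + B⟩` in the stem bracket. -/
def stemSign (x y : Deg n × ℕ) : ℤˣ := sgn ((x.2 : ℤ) • e₁) ((y.2 : ℤ) • e₁ + y.1)

theorem stemSign_add_left (x y z : Deg n × ℕ) :
    stemSign (x + y) z = stemSign x z * stemSign y z := by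
  simp only [stemSign, Prod.snd_add, Nat.cast_add, add_smul, sgn_add_left]

theorem stemSign_add_right (x y z : Deg n × ℕ) :
    stemSign x (y + z) = stemSign x y * stemSign x z := by
  simp only [stemSign, Prod.snd_add, Prod.fst_add, Nat.cast_add, add_smul, sgn_add_right]
  exact mul_mul_mul_comm _ _ _ _

/-- The map `φ` turns the stem bracket into the graded commutator of coderivations, up to a sign. -/
theorem phi_stemHom (x y : Deg n × ℕ) (f : Mult 𝒱 x) (g : Mult 𝒱 y) :
    phi 𝒱 (x + y) (stemHom 𝒱 x y f g) =
      -(stemSign x y • commutator (wt x) (wt y) (phi 𝒱 x f) (phi 𝒱 y g)) := by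
  have hc : IsCoderivation (desusp 𝒱) (wt (x + y))
      (commutator (wt x) (wt y) (phi 𝒱 x f) (phi 𝒱 y g)) := by
    rw [wt_add]
    exact (phi_isCoderivation 𝒱 x f).commutator (phi_isCoderivation 𝒱 y g)
  have h : stemHom 𝒱 x y f g = -(stemSign x y • (⟨phiInv 𝒱 (x + y) _, phiInv_mem 𝒱 (x + y) hc.1⟩ :
      Mult 𝒱 (x + y))) := Subtype.ext (by
    change stemMap 𝒱 x y f g = _
    rw [stemMap_apply]
    change -(stemSign x y • phiInv 𝒱 (x + y)
      (commutator (wt x) (wt y) (phi 𝒱 x f) (phi 𝒱 y g))) = _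
    rcases Int.units_eq_one_or (stemSign x y) with hs | hs
    · rw [hs, one_smul, one_smul]
      rfl
    · rw [hs, Units.neg_smul, one_smul, Units.neg_smul, one_smul]
      rfl)
  rw [h, map_neg, map_units_smul, phi_phiInv 𝒱 hc fun r _ hr =>
    corestriction_commutator_phi 𝒱 x y f g hr]

end Phi

/-! ### Loday structures -/

section Loday

variable {K V : Type*} [Field K] [AddCommGroup V] [Module K V]
variable {n : ℕ}

/-- The bilinear map given by a multilinear map in two variables. -/
def bilin (f : MultilinearMap K (fun _ : Fin 2 => V) V) : V →ₗ[K] V →ₗ[K] V :=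
  LinearMap.mk₂ K (fun x y => f ![x, y])
    (fun x x' y => f.cons_add ![y] x x') (fun c x y => f.cons_smul ![y] c x)
    (fun x y y' => (f.curryLeft x).cons_add ![] y y')
    (fun c x y => (f.curryLeft x).cons_smul ![] c y)

theorem bilin_apply (f : MultilinearMap K (fun _ : Fin 2 => V) V) (x y : V) :
    bilin f x y = f ![x, y] := rfl

theorem curryLeft_apply_const (f : MultilinearMap K (fun _ : Fin 2 => V) V) (x y : V) :
    f.curryLeft x (fun _ => y) = bilin f x y := by
  rw [MultilinearMap.curryLeft_apply, bilin_apply]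
  congr 1
  funext i
  cases i using Fin.cases with
  | zero => rfl
  | succ i => rw [Subsingleton.elim (α := Fin 1) i 0]; rfl

theorem word_three (a b c : V) :
    word K 3 ![a, b, c] = cons a (cons b (word K 1 fun _ => c)) := by
  rw [word_succ_succ, word_succ_succ]
  congr 3
  funext i
  rw [Subsingleton.elim (α := Fin 1) i 0]
  rfl

section Square

variable (𝒱 : Deg n → Submodule K V) [DirectSum.Decomposition 𝒱]

theorem extend_cons_word_one (D : Deg n) (q : MultilinearMap K (fun _ : Fin 2 => V) V)
    {α β : Deg n} {a b : V} (ha : a ∈ 𝒱 α) (hb : b ∈ 𝒱 β) :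
    extend 𝒱 D q (cons a (word K 1 fun _ => b)) = word K 1 fun _ => bilin q a b := by
  have h := LinearMap.congr_fun (extend_cons_succ 𝒱 D q ha) (word K 1 fun _ => b)
  simp only [LinearMap.comp_apply, LinearMap.add_apply, LinearMap.smul_apply] at h
  rw [h, extend_word_one_succ 𝒱 D q hb, extend_word_one_zero 𝒱 _ _ hb, map_zero, smul_zero,
    zero_add, curryLeft_apply_const]

/-- The square of the coderivation attached to a bilinear map, on words of length `3`. -/
theorem pr_extend_extend {D : Deg n} {q : MultilinearMap K (fun _ : Fin 2 => V) V}
    (hq : q ∈ Mult 𝒱 (D, 1)) {α β γ : Deg n} {a b c : V} (ha : a ∈ 𝒱 α) (hb : b ∈ 𝒱 β)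
    (hc : c ∈ 𝒱 γ) :
    pr K (extend 𝒱 D q (extend 𝒱 D q (word K 3 ![a, b, c]))) =
      sgn D α • bilin q a (bilin q b c) + sgn (D + α) β • bilin q b (bilin q a c) +
        bilin q (bilin q a b) c := by
  have hmem : ∀ {α β : Deg n} {a b : V}, a ∈ 𝒱 α → b ∈ 𝒱 β →
      bilin q a b ∈ 𝒱 (D + (α + β)) := fun {α β a b} ha hb => by
    simpa [bilin_apply] using hq ![α, β] ![a, b] fun i => by fin_cases i <;> simpa
  have h1 := LinearMap.congr_fun (extend_cons_succ 𝒱 D q ha) (cons b (word K 1 fun _ => c))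
  have h2 := LinearMap.congr_fun (extend_cons_zero 𝒱 (D + α) (q.curryLeft a) hb)
    (word K 1 fun _ => c)
  simp only [LinearMap.comp_apply, LinearMap.add_apply, LinearMap.smul_apply] at h1 h2
  rw [word_three, h1, h2, extend_cons_word_one 𝒱 D q hb hc, extend_word_one_zero 𝒱 _ _ hc,
    curryLeft_apply_const, curryLeft_apply_const]
  simp only [map_add, map_units_smul]
  rw [extend_cons_word_one 𝒱 D q ha (hmem hb hc), extend_cons_word_one 𝒱 D q hb (hmem ha hc),
    extend_cons_word_one 𝒱 D q (hmem ha hb) hc, pr_word_one, pr_word_one, pr_word_one, add_assoc]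

end Square

variable [NeZero n] (𝒱 : Deg n → Submodule K V)

theorem mem_desusp_sub {α : Deg n} {a : V} (ha : a ∈ 𝒱 α) : a ∈ desusp 𝒱 (α - e₁) := by
  simpa [desusp] using ha

variable [DirectSum.Decomposition 𝒱]

theorem phi_zero_one_eq_extend (π : Mult 𝒱 ((0 : Deg n), 1)) :
    ∃ q ∈ Mult (desusp 𝒱) (e₁, 1), phi 𝒱 (0, 1) π = extend (desusp 𝒱) e₁ q ∧
      ∀ (α β : Deg n) (a b : V), a ∈ 𝒱 α → b ∈ 𝒱 β →
        bilin q a b = -(sgn e₁ (α - e₁) • bilin π.1 a b) := by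
  obtain ⟨q, hq, hext, hval⟩ : ∃ q ∈ Mult (desusp 𝒱) (wt ((0 : Deg n), 1), 1),
      phi 𝒱 (0, 1) π = extend (desusp 𝒱) (wt ((0 : Deg n), 1)) q ∧
      q = (-1 : K) ^ (1 * (1 + 1) / 2) • signed (desusp 𝒱) suspSign π.1 :=
    ⟨_, Submodule.smul_mem _ _ (signed_mem_Mult (x := (wt ((0 : Deg n), 1), 1)) (desusp 𝒱) suspSign
      ((mem_Mult_desusp 𝒱 0 1 _).2 π.2)), rfl, rfl⟩
  rw [wt_zero_one] at hq hext
  refine ⟨q, hq, hext, fun α β a b ha hb => ?_⟩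
  have h := signed_apply (desusp 𝒱) suspSign π.1 ![α - e₁, β - e₁] ![a, b] fun i => by
    fin_cases i
    · exact mem_desusp_sub 𝒱 ha
    · exact mem_desusp_sub 𝒱 hb
  have hs : suspSign ![α - e₁, β - e₁] = sgn e₁ (α - e₁) := by
    rw [suspSign, Fin.prod_univ_two]
    norm_num
  rw [bilin_apply, bilin_apply, hval, smul_apply, h, hs, show 1 * (1 + 1) / 2 = 1 from rfl,
    pow_one, neg_smul, one_smul]

/-- The square of `φ_{(0,1)}(π)` on words of length `3` measures the failure of the graded Loday
identity for `π`. -/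
theorem pr_phi_phi (π : Mult 𝒱 ((0 : Deg n), 1)) {α β γ : Deg n} {a b c : V}
    (ha : a ∈ 𝒱 α) (hb : b ∈ 𝒱 β) (hc : c ∈ 𝒱 γ) :
    pr K (phi 𝒱 (0, 1) π (phi 𝒱 (0, 1) π (word K 3 ![a, b, c]))) =
      sgn e₁ (β - e₁) • (bilin π.1 a (bilin π.1 b c) -
        (bilin π.1 (bilin π.1 a b) c + sgn α β • bilin π.1 b (bilin π.1 a c))) := by
  obtain ⟨q, hq, hext, hval⟩ := phi_zero_one_eq_extend 𝒱 π
  have hmem : ∀ {α β : Deg n} {a b : V}, a ∈ 𝒱 α → b ∈ 𝒱 β →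
      bilin π.1 a b ∈ 𝒱 (α + β) := fun {α β a b} ha hb => by
    have := π.2 ![α, β] ![a, b] fun i => by
      fin_cases i
      · exact ha
      · exact hb
    rwa [zero_add, Fin.sum_univ_two] at this
  rw [hext, pr_extend_extend (desusp 𝒱) hq (mem_desusp_sub 𝒱 ha) (mem_desusp_sub 𝒱 hb)
    (mem_desusp_sub 𝒱 hc), hval _ _ _ _ hb hc, hval _ _ _ _ ha hc, hval _ _ _ _ ha hb]
  simp only [map_neg, map_units_smul, LinearMap.neg_apply, LinearMap.smul_apply]
  rw [hval _ _ _ _ ha (hmem hb hc), hval _ _ _ _ hb (hmem ha hc), hval _ _ _ _ (hmem ha hb) hc]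
  have hneg : ∀ x y : Deg n, sgn x (y - e₁) = sgn x y * sgn x e₁ := fun x y => by
    rw [← sgn_add_right, sgn, sgn, Int.negOnePow_eq_iff, ← dotProduct_sub]
    refine ⟨-dotProduct x e₁, ?_⟩
    simp only [dotProduct_sub, dotProduct_add]
    ring
  have hadd : e₁ + (α - e₁) = α := by abel
  rw [hadd]
  simp only [hneg, sgn_add_right, sgn_e₁_e₁, sgn_comm α e₁]
  rcases Int.units_eq_one_or (sgn e₁ α) with h1 | h1 <;>
  rcases Int.units_eq_one_or (sgn e₁ β) with h2 | h2 <;>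
  rcases Int.units_eq_one_or (sgn α β) with h3 | h3 <;>
  simp only [h1, h2, h3, mul_one, mul_neg, neg_neg, one_smul, Units.neg_smul] <;> abel

/-- A bilinear map of weight `0` is a graded Loday structure if and only if the coderivation
attached to it squares to zero. -/
theorem mem_Lod_iff [CharZero K] (π : Mult 𝒱 ((0 : Deg n), 1)) :
    π ∈ Lod 𝒱 ↔ phi 𝒱 (0, 1) π ∘ₗ phi 𝒱 (0, 1) π = 0 := by
  constructor
  · intro h
    have hc : commutator (wt ((0 : Deg n), 1)) (wt ((0 : Deg n), 1)) (phi 𝒱 (0, 1) π)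
        (phi 𝒱 (0, 1) π) = (2 : K) • (phi 𝒱 (0, 1) π ∘ₗ phi 𝒱 (0, 1) π) := by
      rw [commutator_apply, wt_zero_one, sgn_e₁_e₁, two_smul]
      simp
    have h0 : (2 : K) • (phi 𝒱 (0, 1) π ∘ₗ phi 𝒱 (0, 1) π) = 0 := by
      rw [← hc]
      refine ((phi_isCoderivation 𝒱 (0, 1) π).commutator
        (phi_isCoderivation 𝒱 (0, 1) π)).eq_zero fun r _ => ?_
      by_cases hr : r = 3
      · subst hr
        rw [hc]
        refine ext_homogeneous 𝒱 fun d v hv => ?_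
        have hv3 : v = ![v 0, v 1, v 2] := by
          funext i
          fin_cases i <;> rfl
        have h3 := pr_phi_phi 𝒱 π (hv 0) (hv 1) (hv 2)
        simp only [bilin_apply] at h3
        rw [h _ _ _ _ _ _ (hv 0) (hv 1) (hv 2), sub_self, smul_zero, ← hv3] at h3
        simp [corestriction, h3]
      · exact corestriction_commutator_phi 𝒱 (0, 1) (0, 1) π π hr
    exact (smul_eq_zero.1 h0).resolve_left two_ne_zero
  · intro h α β γ a b c ha hb hc
    have h3 := pr_phi_phi 𝒱 π ha hb hc
    rw [← LinearMap.comp_apply (phi 𝒱 (0, 1) π), h, LinearMap.zero_apply, map_zero, eq_comm,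
      smul_eq_zero_iff_eq, sub_eq_zero] at h3
    exact h3

theorem bijOn_phi_Lod [CharZero K] :
    Set.BijOn (phi 𝒱 (0, 1)) (Lod 𝒱) (CoDiff (desusp 𝒱) e₁ 2) := by
  refine ⟨fun π hπ => ⟨?_, (mem_Lod_iff 𝒱 π).1 hπ, fun r _ hr =>
    corestriction_phi_of_ne 𝒱 (0, 1) π hr⟩, (phi_injective 𝒱 (0, 1)).injOn, ?_⟩
  · have := phi_isCoderivation 𝒱 (0, 1) π
    rwa [wt_zero_one] at this
  · rintro Q ⟨hQ, hQQ, hr⟩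
    rw [← wt_zero_one] at hQ
    have h := phi_phiInv 𝒱 hQ hr
    exact ⟨_, (mem_Lod_iff 𝒱 _).2 (by rw [h, hQQ]), h⟩

end Loday

/-! ### The graded Lie algebra `M_r(V)` -/

section LieAlgebra

variable {K V : Type*} [Field K] [AddCommGroup V] [Module K V] {n : ℕ}

/-- The degree `(A, a)` in `ℤⁿ⁺¹`. -/
def toDeg (x : Deg n × ℕ) : Deg (n + 1) := Fin.snoc x.1 (x.2 : ℤ)

theorem toDeg_add (x y : Deg n × ℕ) : toDeg (x + y) = toDeg x + toDeg y := by
  funext i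
  cases i using Fin.lastCases <;> simp [toDeg]

theorem dotProduct_toDeg (x y : Deg n × ℕ) :
    dotProduct (toDeg x) (toDeg y) = dotProduct x.1 y.1 + x.2 * y.2 := by
  simp [dotProduct, toDeg, Fin.sum_univ_castSucc]

theorem sgn_toDeg [NeZero n] (x y : Deg n × ℕ) :
    sgn (toDeg x) (toDeg y) = sgn (wt x) (wt y) * (stemSign x y * stemSign y x) := by
  have h1 : dotProduct (e₁ : Deg n) e₁ = 1 := by simp [e₁]
  simp only [stemSign, sgn, ← Int.negOnePow_add]
  rw [Int.negOnePow_eq_iff, dotProduct_toDeg]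
  simp only [add_dotProduct, dotProduct_add, smul_dotProduct, dotProduct_smul, h1, smul_eq_mul,
    dotProduct_comm x.1 e₁]
  refine ⟨-(x.2 * y.2 + x.2 * dotProduct e₁ y.1 + y.2 * dotProduct e₁ x.1), ?_⟩
  ring

variable (𝒱 : Deg n → Submodule K V)

theorem grading_toDeg (x : Deg n × ℕ) :
    Mr.grading 𝒱 (toDeg x) = LinearMap.range (Mr.incl 𝒱 x) := by
  have h : ∀ a : ℕ, (a : ℤ) = toDeg x (Fin.last n) ↔ a = x.2 := fun a => by simp [toDeg]
  simp only [Mr.grading, h, iSup_iSup_eq_left]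
  rw [show Fin.init (toDeg x) = x.1 by simp [toDeg]]

theorem grading_eq_bot_or (D : Deg (n + 1)) :
    Mr.grading 𝒱 D = ⊥ ∨ ∃ x : Deg n × ℕ, D = toDeg x := by
  by_cases h : ∃ a : ℕ, (a : ℤ) = D (Fin.last n)
  · obtain ⟨a, ha⟩ := h
    exact Or.inr ⟨(Fin.init D, a), by rw [toDeg, ha, Fin.snoc_init_self]⟩
  · left
    rw [not_exists] at h
    simp [Mr.grading, h]

theorem Mr.incl_injective (x : Deg n × ℕ) : Function.Injective (Mr.incl 𝒱 x) :=
  DirectSum.of_injective x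

/-- The projection of `M_r(V)` to `M^{(A,a)}(V)`, for `x = (A, a)`. -/
def Mr.proj (x : Deg n × ℕ) : Mr 𝒱 →ₗ[K] Mult 𝒱 x :=
  DirectSum.component K (Deg n × ℕ) (fun x => Mult 𝒱 x) x

theorem Mr.proj_incl (x : Deg n × ℕ) (f : Mult 𝒱 x) : Mr.proj 𝒱 x (Mr.incl 𝒱 x f) = f :=
  DirectSum.component.lof_self K (M := fun x => Mult 𝒱 x) x f

theorem Mr.proj_incl_of_ne {x y : Deg n × ℕ} (h : x ≠ y) (f : Mult 𝒱 y) :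
    Mr.proj 𝒱 x (Mr.incl 𝒱 y f) = 0 :=
  DirectSum.of_eq_of_ne (β := fun y => Mult 𝒱 y) _ _ f h

theorem grading_isInternal : DirectSum.IsInternal (Mr.grading 𝒱) := by
  refine (DirectSum.isInternal_submodule_iff_iSupIndep_and_iSup_eq_top _).2 ⟨?_, ?_⟩
  · intro D
    rcases grading_eq_bot_or 𝒱 D with hD | ⟨x, rfl⟩
    · rw [hD]
      exact disjoint_bot_left
    · have hle : ⨆ (E) (_ : E ≠ toDeg x), Mr.grading 𝒱 E ≤ LinearMap.ker (Mr.proj 𝒱 x) := by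
        refine iSup₂_le fun E hE => ?_
        rcases grading_eq_bot_or 𝒱 E with h | ⟨y, rfl⟩
        · rw [h]
          exact bot_le
        · rw [grading_toDeg]
          rintro _ ⟨f, rfl⟩
          exact Mr.proj_incl_of_ne 𝒱 (fun h => hE (congrArg toDeg h.symm)) f
      refine Disjoint.mono_right hle (Submodule.disjoint_def.2 ?_)
      rw [grading_toDeg]
      rintro _ ⟨f, rfl⟩ hf
      rw [← Mr.proj_incl 𝒱 x f, LinearMap.mem_ker.1 hf, map_zero]
  · rw [eq_top_iff]
    rintro z -
    induction z using DirectSum.induction_on with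
    | zero => exact zero_mem _
    | of x f =>
      exact le_iSup (Mr.grading 𝒱) (toDeg x) (by rw [grading_toDeg]; exact ⟨f, rfl⟩)
    | add y z hy hz => exact add_mem hy hz

variable [NeZero n] [DirectSum.Decomposition 𝒱]

theorem Mr.exists_incl_eq {x y : Deg n × ℕ} (h : x = y) (f : Mult 𝒱 x) :
    ∃ g : Mult 𝒱 y, Mr.incl 𝒱 y g = Mr.incl 𝒱 x f ∧ phi 𝒱 y g = phi 𝒱 x f := by
  subst h
  exact ⟨f, rfl, rfl⟩

theorem stemBracket_skew (x y : Deg n × ℕ) (f : Mult 𝒱 x) (g : Mult 𝒱 y) :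
    stemBracket 𝒱 (Mr.incl 𝒱 x f) (Mr.incl 𝒱 y g) =
      -(sgn (toDeg x) (toDeg y) • stemBracket 𝒱 (Mr.incl 𝒱 y g) (Mr.incl 𝒱 x f)) := by
  rw [stemBracket_incl, stemBracket_incl]
  obtain ⟨k, hk, hk'⟩ := Mr.exists_incl_eq 𝒱 (add_comm y x) (stemHom 𝒱 y x g f)
  rw [← hk, ← map_units_smul, ← map_neg]
  congr 1
  apply phi_injective
  rw [map_neg, map_units_smul, hk', phi_stemHom, phi_stemHom, commutator_skew, smul_neg, smul_neg,
    smul_smul, smul_smul, sgn_toDeg]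
  congr 3
  rw [mul_assoc, mul_assoc, Int.units_mul_self, mul_one, mul_comm]

theorem stemBracket_jacobi (x y z : Deg n × ℕ) (f : Mult 𝒱 x) (g : Mult 𝒱 y) (h : Mult 𝒱 z) :
    stemBracket 𝒱 (Mr.incl 𝒱 x f) (stemBracket 𝒱 (Mr.incl 𝒱 y g) (Mr.incl 𝒱 z h)) =
      stemBracket 𝒱 (stemBracket 𝒱 (Mr.incl 𝒱 x f) (Mr.incl 𝒱 y g)) (Mr.incl 𝒱 z h) +
        sgn (toDeg x) (toDeg y) •
          stemBracket 𝒱 (Mr.incl 𝒱 y g) (stemBracket 𝒱 (Mr.incl 𝒱 x f) (Mr.incl 𝒱 z h)) := by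
  simp only [stemBracket_incl]
  obtain ⟨k, hk, hk'⟩ := Mr.exists_incl_eq 𝒱 (add_assoc x y z)
    (stemHom 𝒱 (x + y) z (stemHom 𝒱 x y f g) h)
  obtain ⟨l, hl, hl'⟩ := Mr.exists_incl_eq 𝒱 (add_left_comm y x z)
    (stemHom 𝒱 y (x + z) g (stemHom 𝒱 x z f h))
  rw [← hk, ← hl, ← map_units_smul, ← LinearMap.map_add (Mr.incl 𝒱 (x + (y + z)))]
  congr 1
  apply phi_injective
  rw [map_add, map_units_smul, hk', hl']
  simp only [phi_stemHom, wt_add, map_neg, map_units_smul, LinearMap.neg_apply,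
    LinearMap.smul_apply, smul_neg, neg_neg, smul_smul]
  -- the signs of the stem bracket contribute the same factor to the three terms
  have hs1 : stemSign x (y + z) * stemSign y z = stemSign (x + y) z * stemSign x y := by
    rw [stemSign_add_left, stemSign_add_right]
    ac_rfl
  have hs2 : sgn (toDeg x) (toDeg y) * (stemSign y (x + z) * stemSign x z) =
      stemSign (x + y) z * stemSign x y * sgn (wt x) (wt y) := by
    rw [stemSign_add_left, stemSign_add_right, sgn_toDeg]
    have := Int.units_mul_self (stemSign y x)
    calc _ = stemSign x z * stemSign y z * stemSign x y * sgn (wt x) (wt y) *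
          (stemSign y x * stemSign y x) := by ac_rfl
      _ = _ := by rw [this, mul_one]
  rw [hs1, commutator_jacobi, smul_add, smul_smul, hs2]

theorem stemBracket_isGradedLieAlgebra :
    IsGradedLieAlgebra (Mr.grading 𝒱) (stemBracket 𝒱) where
  isInternal := grading_isInternal 𝒱
  weight_zero a b x y hx hy := by
    rcases grading_eq_bot_or 𝒱 a with h | ⟨a, rfl⟩
    · rw [h, Submodule.mem_bot] at hx
      simp [hx]
    rcases grading_eq_bot_or 𝒱 b with h | ⟨b, rfl⟩
    · rw [h, Submodule.mem_bot] at hy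
      simp [hy]
    rw [grading_toDeg] at hx hy
    obtain ⟨f, rfl⟩ := hx
    obtain ⟨g, rfl⟩ := hy
    rw [stemBracket_incl, ← toDeg_add, grading_toDeg]
    exact ⟨_, rfl⟩
  skew a b x y hx hy := by
    rcases grading_eq_bot_or 𝒱 a with h | ⟨a, rfl⟩
    · rw [h, Submodule.mem_bot] at hx
      simp [hx]
    rcases grading_eq_bot_or 𝒱 b with h | ⟨b, rfl⟩
    · rw [h, Submodule.mem_bot] at hy
      simp [hy]
    rw [grading_toDeg] at hx hy
    obtain ⟨f, rfl⟩ := hx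
    obtain ⟨g, rfl⟩ := hy
    exact stemBracket_skew 𝒱 a b f g
  jacobi a b c x y z hx hy hz := by
    rcases grading_eq_bot_or 𝒱 a with h | ⟨a, rfl⟩
    · rw [h, Submodule.mem_bot] at hx
      simp [hx]
    rcases grading_eq_bot_or 𝒱 b with h | ⟨b, rfl⟩
    · rw [h, Submodule.mem_bot] at hy
      simp [hy]
    rcases grading_eq_bot_or 𝒱 c with h | ⟨c, rfl⟩
    · rw [h, Submodule.mem_bot] at hz
      simp [hz]
    rw [grading_toDeg] at hx hy hz
    obtain ⟨f, rfl⟩ := hx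
    obtain ⟨g, rfl⟩ := hy
    obtain ⟨h, rfl⟩ := hz
    exact stemBracket_jacobi 𝒱 a b c f g h

theorem stemBracket_self_eq_zero_iff [CharZero K] (π : Mult 𝒱 ((0 : Deg n), 1)) :
    stemBracket 𝒱 (Mr.incl 𝒱 (0, 1) π) (Mr.incl 𝒱 (0, 1) π) = 0 ↔ π ∈ Lod 𝒱 := by
  rw [stemBracket_incl, map_eq_zero_iff _ (Mr.incl_injective 𝒱 _),
    ← map_eq_zero_iff _ (phi_injective 𝒱 _), phi_stemHom, neg_eq_zero, smul_eq_zero_iff_eq,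
    commutator_apply, wt_zero_one, sgn_e₁_e₁, mem_Lod_iff, Units.neg_smul, one_smul, sub_neg_eq_add,
    ← two_smul K, smul_eq_zero_iff_right two_ne_zero]

theorem image_Lod_eq_canonical [CharZero K] :
    Mr.incl 𝒱 (0, 1) '' Lod 𝒱 =
      {x | IsCanonical (Mr.grading 𝒱) (stemBracket 𝒱) (Fin.snoc (0 : Deg n) (1 : ℤ)) x} := by
  have hd : (Fin.snoc (0 : Deg n) (1 : ℤ) : Deg (n + 1)) = toDeg ((0 : Deg n), 1) := by
    simp [toDeg]
  have hodd : IsOddDeg (toDeg ((0 : Deg n), 1)) := by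
    rw [IsOddDeg, dotProduct_toDeg]
    simp
  rw [hd]
  ext x
  constructor
  · rintro ⟨π, hπ, rfl⟩
    exact ⟨by rw [grading_toDeg]; exact ⟨π, rfl⟩, hodd, (stemBracket_self_eq_zero_iff 𝒱 π).2 hπ⟩
  · rintro ⟨hx, -, h0⟩
    rw [grading_toDeg] at hx
    obtain ⟨π, rfl⟩ := hx
    exact ⟨π, (stemBracket_self_eq_zero_iff 𝒱 π).1 h0, rfl⟩

end LieAlgebra

end StemBracket

end

theorem mainTheorem4 {K V : Type*} [Field K] [CharZero K] [AddCommGroup V] [Module K V]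
    {n : ℕ} [NeZero n] (𝒱 : StemBracket.Deg n → Submodule K V) [DirectSum.Decomposition 𝒱] :
    Set.BijOn (StemBracket.phi 𝒱 (0, 1)) (StemBracket.Lod 𝒱)
      (StemBracket.CoDiff (StemBracket.desusp 𝒱) StemBracket.e₁ 2) ∧
    StemBracket.IsGradedLieAlgebra (StemBracket.Mr.grading 𝒱) (StemBracket.stemBracket 𝒱) ∧
    StemBracket.Mr.incl 𝒱 (0, 1) '' StemBracket.Lod 𝒱 =
      {x | StemBracket.IsCanonical (StemBracket.Mr.grading 𝒱) (StemBracket.stemBracket 𝒱)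
        (Fin.snoc (0 : StemBracket.Deg n) (1 : ℤ)) x} :=
  ⟨StemBracket.bijOn_phi_Lod 𝒱, StemBracket.stemBracket_isGradedLieAlgebra 𝒱,
    StemBracket.image_Lod_eq_canonical 𝒱⟩
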